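/- Consider $N$ nodes that estimate an unknown vector $x_0\in\mathbb R^n$ from the measurements $z_i(k)=H_i(k)x_0+v_i(k)$, $i=1,\dots,N$, $k\ge 0$, where $H_i(k)\in\mathbb R^{n_i\times n}$ is a random observation matrix and $v_i(k)\in\mathbb R^{n_i}$ is noise. The communication graph at time $k$ is given by a random weighted adjacency matrix $\mathcal A(k)=[a_{ij}(k)]\in\mathbb R^{N\times N}$ with $a_{ii}(k)=0$ a.s., and $\mathcal N_i(k)=\{j: a_{ij}(k)\ne 0\}$. Starting from deterministic initial estimates $x_i(0)\in\mathbb R^n$, the nodes run the delay-free algorithm $$x_i(k+1)=x_i(k)+a(k)H_i(k)^T\bigl(z_i(k)-H_i(k)x_i(k)\bigr)+b(k)\sum_{j\in\mathcal N_i(k)}a_{ij}(k)\bigl(x_j(k)-x_i(k)\bigr),\quad k\ge 0 .$$ Write $v(k)=(v_i(k))_{i}$, $H(k)=(H_i(k))_i$, and let $\mathcal F(k)$ be the $\sigma$-algebra generated by $\mathcal A(s),v(s),H(s)$, $0\le s\le k$, with $\mathcal F(-1)$ trivial. Suppose: (A1.a) The sequence $\{v(k)\}$ is independent of the sequence $\{(H(k),\mathcal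 A(k))\}$. (A1.b) $\{v(k),\mathcal F(k)\}$ is a martingale difference sequence, and there is a constant $\beta_v>0$ with $\sup_{k\ge0}\mathbb E[\|v(k)\|^2\mid\mathcal F(k-1)]\le\beta_v$ a.s. (A3.a) $\{a(k)\}$ and $\{b(k)\}$ are positive real sequences monotonically decreasing to zero, $a(k)=O(b(k))$, $a(k)=O(a(k+m))$ for every positive integer $m$, $b^2(k)=o(a(k))$ as $k\to\infty$, and $\sum_{k=0}^\infty a(k)=\infty$. (A3.b) $\sum_{k=0}^\infty b^2(k)<\infty$. (A4) $\{(H(k),\mathcal A(k)),k\ge0\}$ is a homogeneous Markov chain on a countable state space $\mathcal S=\{((H_{i,l})_{i=1}^N,\mathcal A_l): l=1,2,\dots\}$ with a unique stationary distribution $\pi=(\pi_l)$. It is uniformly ergodic: there are constants $r>1$ and $R>0$ such that its $k$-step transition probabilities satisfy $\sum_{y\in\mathcal S}|\mathbb P^k(s,y)-\pi(y)|\le R r^{-k}$ for all $s\in\mathcal S$ and all $k\ge 0$. Suppose further that, in the matrix 2-norm, $\sup_l\|\mathcal A_l\|<\infty$ and $\sup_l\|\mathrm{diag}(H_{1,l},\dots,H_{N,l})\|<\infty$,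 and that (c.1) the stationary weighted adjacency matrix $\sum_{l}\pi_l\mathcal A_l$ is entrywise nonnegative, and its digraph (with an edge from $j$ to $i$ whenever the $(i,j)$ entry is nonzero) is balanced (the sum of the $i$-th row equals the sum of the $i$-th column for every $i$) and contains a directed spanning tree; (c.2) the measurement model is spatially-temporally jointly observable, i.e. $\lambda_{\min}\Bigl(\sum_{i=1}^N\sum_{l}\pi_lH_{i,l}^TH_{i,l}\Bigr)>0$. Then for every node $i$ the estimates converge to $x_0$ both in mean square, $\lim_{k\to\infty}\mathbb E\|x_i(k)-x_0\|^2=0$, and almost surely, $\lim_{k\to\infty}x_i(k)=x_0$ a.s. -/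

import Mathlib

open MeasureTheory ProbabilityTheory Filter Topology Asymptotics
open scoped Matrix

noncomputable section

/-! ## Matrices and weighted digraphs -/

/-- The product sigma-algebra of the entries. -/
instance matrixMeasurableSpace {m n : Type*} : MeasurableSpace (Matrix m n ℝ) :=
  inferInstanceAs (MeasurableSpace (m → n → ℝ))

/-- The 2-norm of a (rectangular) real matrix: the operator norm between Euclidean spaces. -/
def matrixTwoNorm {m n : Type*} [Fintype m] [Fintype n] [DecidableEq n]
    (B : Matrix m n ℝ) : ℝ :=
  ‖LinearMap.toContinuousLinearMap (Matrix.toEuclideanLin B)‖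

/-- The minimum eigenvalue of a real symmetric matrix (of positive size), whose spectrum is a
finite nonempty set of real numbers. -/
def lambdaMin {n : ℕ} (B : Matrix (Fin n) (Fin n) ℝ) : ℝ :=
  sInf (spectrum ℝ B)

/-- The neighbourhood of node `i`: there is a link from `j` to `i` iff `B i j ≠ 0`. -/
def neighbours {N : ℕ} (B : Matrix (Fin N) (Fin N) ℝ) (i : Fin N) : Finset (Fin N) :=
  open Classical in Finset.univ.filter fun j => B i j ≠ 0

/-- In-degree equals out-degree at every node. -/
def IsBalanced {N : ℕ} (B : Matrix (Fin N) (Fin N) ℝ) : Prop :=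
  ∀ i, ∑ j, B i j = ∑ j, B j i

/-- The digraph of `B` contains a directed spanning tree: there are a root and, for every other
node `i`, an edge from a parent of `i` to `i`, such that following parents leads to the root. -/
def HasSpanningTree {N : ℕ} (B : Matrix (Fin N) (Fin N) ℝ) : Prop :=
  ∃ (root : Fin N) (parent : Fin N → Fin N),
    (∀ i, i ≠ root → B i (parent i) ≠ 0) ∧ ∀ i, ∃ m : ℕ, parent^[m] i = root

/-! ## Markov chains on a countable state space -/

section Markov

variable {S : Type*}

/-- A stochastic matrix. -/
structure IsTransitionMatrix (P : S → S → ℝ) : Prop where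
  nonneg : ∀ s t, 0 ≤ P s t
  hasSum_one : ∀ s, HasSum (P s) 1

/-- A probability distribution `π` with `π P = π`. -/
structure IsStationaryDistribution (P : S → S → ℝ) (π : S → ℝ) : Prop where
  nonneg : ∀ s, 0 ≤ π s
  hasSum_one : HasSum π 1
  stationary : ∀ t, HasSum (fun s => π s * P s t) (π t)

/-- The `k`-step transition probabilities. -/
def transitionPow (P : S → S → ℝ) : ℕ → S → S → ℝ
  | 0 => fun s t => open Classical in if s = t then 1 else 0
  | k + 1 => fun s t => ∑' u, transitionPow P k s u * P u t

/-- Geometric convergence to `π` in total variation, uniformly in the initial state. -/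
def IsUniformlyErgodic (P : S → S → ℝ) (π : S → ℝ) : Prop :=
  ∃ r R : ℝ, 1 < r ∧ 0 < R ∧
    ∀ (k : ℕ) (s : S), ∑' t, |transitionPow P k s t - π t| ≤ R * (r ^ k)⁻¹

end Markov

/-- `Y` is (almost surely) a homogeneous Markov chain with values in the set `S` and transition
matrix `P`. -/
structure IsHomogeneousMarkovChain {Ω α : Type*} [MeasurableSpace Ω] (μ : Measure Ω)
    (S : Set α) (P : S → S → ℝ) (Y : ℕ → Ω → α) : Prop where
  transition : IsTransitionMatrix P
  mem : ∀ k, ∀ᵐ ω ∂μ, Y k ω ∈ S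
  markov : ∀ (k : ℕ) (p : ℕ → S),
    μ.real {ω | ∀ i ≤ k + 1, Y i ω = p i} =
      μ.real {ω | ∀ i ≤ k, Y i ω = p i} * P (p k) (p (k + 1))

/-! ## The estimation problem -/

/-- A family of observation matrices `H i` (of size `d i × n`), one for each node. -/
abbrev ObsFamily (N n : ℕ) (d : Fin N → ℕ) : Type :=
  ∀ i : Fin N, Matrix (Fin (d i)) (Fin n) ℝ

/-- A pair (observation matrices, weighted adjacency matrix). -/
abbrev NetState (N n : ℕ) (d : Fin N → ℕ) : Type :=
  ObsFamily N n d × Matrix (Fin N) (Fin N) ℝ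

/-- One measurement noise vector for each node. -/
abbrev NoiseFamily (N : ℕ) (d : Fin N → ℕ) : Type :=
  ∀ i : Fin N, EuclideanSpace ℝ (Fin (d i))

/-- The block diagonal matrix `diag (H 1, …, H N)`. -/
def blockObs {N n : ℕ} {d : Fin N → ℕ} (H : ObsFamily N n d) :
    Matrix (Σ i : Fin N, Fin (d i)) (Σ _ : Fin N, Fin n) ℝ :=
  Matrix.blockDiagonal' H

/-- The sigma-algebra generated by the observation matrices, adjacency matrices and noises at the
times `0, …, k - 1`; for `k = 0` it is trivial. -/
abbrev pastSigma {Ω : Type*} {N n : ℕ} {d : Fin N → ℕ} (H : ℕ → Ω → ObsFamily N n d)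
    (A : ℕ → Ω → Matrix (Fin N) (Fin N) ℝ) (v : ℕ → Ω → NoiseFamily N d) (k : ℕ) :
    MeasurableSpace Ω :=
  ⨆ s : ℕ, ⨆ _ : s < k,
    MeasurableSpace.comap (fun ω => (H s ω, A s ω, v s ω)) inferInstance

/-- The noise is square integrable, it is a martingale difference sequence, and its conditional
second moments are bounded. -/
structure IsMartingaleDifferenceNoise {Ω : Type*} [MeasurableSpace Ω] (μ : Measure Ω)
    {N n : ℕ} {d : Fin N → ℕ} (H : ℕ → Ω → ObsFamily N n d)
    (A : ℕ → Ω → Matrix (Fin N) (Fin N) ℝ) (v : ℕ → Ω → NoiseFamily N d) : Prop where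
  memLp : ∀ k i, MemLp (fun ω => v k ω i) 2 μ
  condExp_eq_zero : ∀ k i, μ[fun ω => v k ω i | pastSigma H A v k] =ᵐ[μ] 0
  condSecondMoment_le : ∃ β : ℝ, 0 < β ∧ ∀ k,
    ∀ᵐ ω ∂μ, (μ[fun ω => ∑ i, ‖v k ω i‖ ^ 2 | pastSigma H A v k]) ω ≤ β

/-- The conditions on the innovation gains `a` and the consensus gains `b`. -/
structure GainConditions (a b : ℕ → ℝ) : Prop where
  a_pos : ∀ k, 0 < a k
  b_pos : ∀ k, 0 < b k
  a_antitone : Antitone a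
  b_antitone : Antitone b
  a_tendsto : Tendsto a atTop (𝓝 0)
  b_tendsto : Tendsto b atTop (𝓝 0)
  a_isBigO_b : a =O[atTop] b
  a_isBigO_shift : ∀ m : ℕ, 0 < m → a =O[atTop] fun k => a (k + m)
  b_sq_isLittleO_a : (fun k => b k ^ 2) =o[atTop] a
  sum_a : Tendsto (fun K => ∑ k ∈ Finset.range K, a k) atTop atTop

/-- The measurement `z i = H i x₀ + v i` of node `i`. -/
def measurement {N n : ℕ} {d : Fin N → ℕ} (x₀ : EuclideanSpace ℝ (Fin n))
    (H : ObsFamily N n d) (v : NoiseFamily N d) (i : Fin N) : EuclideanSpace ℝ (Fin (d i)) :=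
  Matrix.toEuclideanLin (H i) x₀ + v i

/-- One (delay-free) step of the algorithm at node `i`, with innovation gain `a`, consensus gain
`b`, observation matrices `H`, adjacency matrix `A`, measurements `z` and estimates `x`. -/
def estimateStep {N n : ℕ} {d : Fin N → ℕ} (a b : ℝ) (H : ObsFamily N n d)
    (A : Matrix (Fin N) (Fin N) ℝ) (z : ∀ i : Fin N, EuclideanSpace ℝ (Fin (d i)))
    (x : Fin N → EuclideanSpace ℝ (Fin n)) (i : Fin N) : EuclideanSpace ℝ (Fin n) :=
  x i + a • Matrix.toEuclideanLin (H i)ᵀ (z i - Matrix.toEuclideanLin (H i) (x i))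
    + b • ∑ j ∈ neighbours A i, A i j • (x j - x i)

/-- The mean of the adjacency matrix under `π`. -/
def meanAdjacency {N n : ℕ} {d : Fin N → ℕ} {S : Set (NetState N n d)} (π : S → ℝ) :
    Matrix (Fin N) (Fin N) ℝ :=
  ∑' s : S, π s • s.1.2

/-- The sum over the nodes `i` of the means of `(H i)ᵀ * H i` under `π`. -/
def meanGramian {N n : ℕ} {d : Fin N → ℕ} {S : Set (NetState N n d)} (π : S → ℝ) :
    Matrix (Fin n) (Fin n) ℝ :=
  ∑ i : Fin N, ∑' s : S, π s • ((s.1.1 i)ᵀ * s.1.1 i)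

end

/-! Stack the errors of all nodes into one vector `e`. It obeys `e (k+1) = e k - D k (Y k) (e k) + a
k • w k`, where `Y` is the Markov chain of network states, `w` is the transformed noise and `D k s =
a k • obsOp + b k • lapOp`, evaluated at the state `s`.

If `D k` were its stationary mean `a k • G + b k • L`, then `‖e‖²` would be a Lyapunov function.
Balance makes the quadratic form of `L` a sum of squared differences, the spanning tree makes it
vanish only on consensus vectors, and on those `G` is the mean Gramian, which is positive definite.
Since `a = O(b)`, this gives a decay of order `a k * ‖e‖²` (`exists_mean_coercive`).

The actual operators are neither symmetric nor positive at each time; only their average is good.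
The fluctuation is removed by the Poisson equation: uniform ergodicity gives bounded `g` with `g - P
g = f - π f` (`IsTransitionMatrix.exists_poisson`). Combining the solutions for the two operators
with weights `a k` and `b k` gives a corrector `Γ k` with `D k = (mean) + Γ k - P (Γ k)`. For `U k =
‖e k‖² - 2 ⟪e k, Γ k (Y k) (e k)⟫` the Markov property cancels the fluctuation to first order,
leaving (`condExp_lyapunov_le`) a conditional mean at most `(1 + O(b k ^ 2) + O(Δ k) - c * a k) * U
k + O(a k ^ 2)`. Here `Δ k` bounds the change from `Γ k` to `Γ (k+1)`, and is summable because the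
gains are monotone.

The error terms are summable and `∑ a = ∞`, so a Robbins–Siegmund argument
(`almostSupermartingale_tendsto_zero`) gives convergence of `U`, hence of `‖e‖²`, to zero in mean
and almost surely. Independence of noise and chain supplies the conditional expectations: enlarging
the noise history by the chain keeps the noise centred, and enlarging the chain history by the noise
keeps the Markov property (`condExp_sup_of_indep`). -/

/-! ## Almost supermartingales -/

/-- Telescoping bounds `∑ c k * z k`, and subtracting the partial sums of `δ` makes `z` monotone, so
`z` has a limit. A positive limit would contradict `∑ c = ∞`. -/
theorem tendsto_zero_of_le_sub_mul_add {z c δ : ℕ → ℝ} (hz : ∀ k, 0 ≤ z k) (hc : ∀ k, 0 ≤ c k)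
    (hδ : ∀ k, 0 ≤ δ k) (hstep : ∀ k, z (k + 1) ≤ z k - c k * z k + δ k) (hδs : Summable δ)
    (hcs : Tendsto (fun K => ∑ k ∈ Finset.range K, c k) atTop atTop) :
    Tendsto z atTop (𝓝 0) := by
  have hsum : ∀ K, z K + ∑ k ∈ Finset.range K, c k * z k ≤ z 0 + ∑' k, δ k := by
    intro K
    have h : z K + ∑ k ∈ Finset.range K, c k * z k ≤ z 0 + ∑ k ∈ Finset.range K, δ k := by
      induction K with
      | zero => simp
      | succ K ih =>
        rw [Finset.sum_range_succ, Finset.sum_range_succ]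
        linarith [hstep K]
    linarith [hδs.sum_le_tsum (Finset.range K) fun k _ => hδ k]
  have hanti : Antitone fun k => z k - ∑ j ∈ Finset.range k, δ j := by
    refine antitone_nat_of_succ_le fun k => ?_
    rw [Finset.sum_range_succ]
    nlinarith [hstep k, mul_nonneg (hc k) (hz k)]
  have hbdd : BddBelow (Set.range fun k => z k - ∑ j ∈ Finset.range k, δ j) := by
    refine ⟨-∑' k, δ k, ?_⟩
    rintro _ ⟨k, rfl⟩
    have := hδs.sum_le_tsum (Finset.range k) fun k _ => hδ k
    have := hz k
    simp only
    linarith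
  have hlim := (tendsto_atTop_ciInf hanti hbdd).add hδs.hasSum.tendsto_sum_nat
  simp only [sub_add_cancel] at hlim
  set l := (⨅ i, (z i - ∑ j ∈ Finset.range i, δ j)) + ∑' i, δ i
  have hl : 0 ≤ l := ge_of_tendsto' hlim hz
  rcases hl.eq_or_lt with h0 | hpos
  · rwa [← h0] at hlim
  exfalso
  obtain ⟨K, hK⟩ := eventually_atTop.1 (hlim.eventually_const_le (half_lt_self hpos))
  -- From time `K` on `z k ≥ l / 2`; the finitely many earlier terms are paid for by the constant `l
  -- / 2 * ∑_{k < K} c k`.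
  have hlow : ∀ m, l / 2 * ∑ k ∈ Finset.range m, c k
      ≤ l / 2 * ∑ k ∈ Finset.range K, c k + ∑ k ∈ Finset.range m, c k * z k := by
    intro m
    have : ∑ k ∈ Finset.range m, c k * (l / 2)
        ≤ ∑ k ∈ Finset.range m, ((if k ∈ Finset.range K then c k * (l / 2) else 0) + c k * z k) := by
      refine Finset.sum_le_sum fun k _ => ?_
      split_ifs with h
      · nlinarith [mul_nonneg (hc k) (hz k)]
      · have := hK k (by simpa using h)
        nlinarith [mul_le_mul_of_nonneg_left this (hc k)]
    rw [Finset.sum_add_distrib, ← Finset.sum_filter] at this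
    have h2 : ∑ k ∈ Finset.range m with k ∈ Finset.range K, c k * (l / 2)
        ≤ ∑ k ∈ Finset.range K, c k * (l / 2) :=
      Finset.sum_le_sum_of_subset_of_nonneg (fun k hk => (Finset.mem_filter.1 hk).2)
        fun k _ _ => mul_nonneg (hc k) (half_pos hpos).le
    rw [← Finset.sum_mul] at this
    rw [← Finset.sum_mul (Finset.range K)] at h2
    linarith
  have htop := Tendsto.const_mul_atTop (half_pos hpos) hcs
  obtain ⟨m, hm⟩ := (htop.eventually_gt_atTop
    (l / 2 * ∑ k ∈ Finset.range K, c k + (z 0 + ∑' k, δ k))).exists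
  linarith [hlow m, hsum m, hz m]

theorem one_le_prod_one_add {ε : ℕ → ℝ} (hε : ∀ k, 0 ≤ ε k) (k : ℕ) :
    1 ≤ ∏ j ∈ Finset.range k, (1 + ε j) := by
  induction k with
  | zero => simp
  | succ k ih =>
    rw [Finset.prod_range_succ]
    nlinarith [hε k, ih]

theorem prod_one_add_le_exp_tsum {ε : ℕ → ℝ} (hε : ∀ k, 0 ≤ ε k) (hεs : Summable ε) (k : ℕ) :
    ∏ j ∈ Finset.range k, (1 + ε j) ≤ Real.exp (∑' j, ε j) := by
  calc ∏ j ∈ Finset.range k, (1 + ε j) ≤ ∏ j ∈ Finset.range k, Real.exp (ε j) :=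
        Finset.prod_le_prod (fun j _ => by linarith [hε j])
          fun j _ => by linarith [Real.add_one_le_exp (ε j)]
    _ = Real.exp (∑ j ∈ Finset.range k, ε j) := (Real.exp_sum _ _).symm
    _ ≤ _ := Real.exp_le_exp.2 (hεs.sum_le_tsum _ fun j _ => hε j)

/-- Dividing by `∏ (1 + ε j)`, which stays between `1` and `exp (∑ ε)`, absorbs the growth factors
and reduces to the case `ε = 0`. -/
theorem tendsto_zero_of_almost_contracting {y ε c δ : ℕ → ℝ} (hy : ∀ k, 0 ≤ y k)
    (hε : ∀ k, 0 ≤ ε k) (hc : ∀ k, 0 ≤ c k) (hδ : ∀ k, 0 ≤ δ k)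
    (hstep : ∀ k, y (k + 1) ≤ (1 + ε k - c k) * y k + δ k) (hεs : Summable ε) (hδs : Summable δ)
    (hcs : Tendsto (fun K => ∑ k ∈ Finset.range K, c k) atTop atTop) :
    Tendsto y atTop (𝓝 0) := by
  set p : ℕ → ℝ := fun k => ∏ j ∈ Finset.range k, (1 + ε j) with hp
  set M := Real.exp (∑' j, ε j)
  have hp1 : ∀ k, 1 ≤ p k := one_le_prod_one_add hε
  have hpM : ∀ k, p k ≤ M := prod_one_add_le_exp_tsum hε hεs
  have hp0 : ∀ k, 0 < p k := fun k => lt_of_lt_of_le one_pos (hp1 k)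
  have hM : 0 < M := Real.exp_pos _
  have hpsucc : ∀ k, p (k + 1) = p k * (1 + ε k) := fun k => Finset.prod_range_succ _ _
  have hz : Tendsto (fun k => y k / p k) atTop (𝓝 0) := by
    -- The normalisation weakens the drift by at most the factor `M`, so its sum still diverges.
    refine tendsto_zero_of_le_sub_mul_add (c := fun k => c k / M)
      (fun k => div_nonneg (hy k) (hp0 k).le) (fun k => div_nonneg (hc k) hM.le) hδ ?_ hδs ?_
    · intro k
      rw [div_le_iff₀ (hp0 (k + 1))]
      have h1 : y k / p k * p (k + 1) = (1 + ε k) * y k := by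
        rw [hpsucc]; field_simp [(hp0 k).ne']
      have h2 : c k / M * (y k / p k) * p (k + 1) ≤ c k * y k := by
        have e : c k / M * (y k / p k) * p (k + 1) = (c k * y k) * (1 / p k) * (p (k + 1) / M) := by
          ring
        rw [e]
        have a1 : 1 / p k ≤ 1 := by rw [div_le_one (hp0 k)]; exact hp1 k
        have a2 : p (k + 1) / M ≤ 1 := by rw [div_le_one hM]; exact hpM _
        have a3 : 0 ≤ c k * y k := mul_nonneg (hc k) (hy k)
        calc (c k * y k) * (1 / p k) * (p (k + 1) / M) ≤ (c k * y k) * 1 * 1 := by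
              gcongr
              exact div_nonneg (hp0 _).le hM.le
          _ = _ := by ring
      have h3 : δ k ≤ δ k * p (k + 1) := le_mul_of_one_le_right (hδ k) (hp1 _)
      calc y (k + 1) ≤ (1 + ε k - c k) * y k + δ k := hstep k
        _ ≤ y k / p k * p (k + 1) - c k / M * (y k / p k) * p (k + 1) + δ k * p (k + 1) := by
          rw [h1]; linarith
        _ = _ := by ring
    · simp_rw [← Finset.sum_div]
      exact hcs.atTop_div_const hM
  refine squeeze_zero hy (fun k => ?_) (by simpa using hz.const_mul M)
  calc y k = p k * (y k / p k) := by field_simp [(hp0 k).ne']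
    _ ≤ M * (y k / p k) := by
      gcongr
      · exact div_nonneg (hy k) (hp0 k).le
      · exact hpM k

/-- Robbins–Siegmund type theorem: a nonnegative almost supermartingale with a multiplicative
drift whose sum diverges tends to zero in mean and almost surely. -/
theorem almostSupermartingale_tendsto_zero {Ω : Type*} [m0 : MeasurableSpace Ω] {μ : Measure Ω}
    [IsProbabilityMeasure μ] (𝒢 : Filtration ℕ m0) {U : ℕ → Ω → ℝ} {ε c δ : ℕ → ℝ}
    (hadp : StronglyAdapted 𝒢 U) (hint : ∀ k, Integrable (U k) μ) (hU : ∀ k, 0 ≤ᵐ[μ] U k)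
    (hε : ∀ k, 0 ≤ ε k) (hc : ∀ k, 0 ≤ c k) (hδ : ∀ k, 0 ≤ δ k)
    (hstep : ∀ k, μ[U (k + 1) | 𝒢 k] ≤ᵐ[μ] fun ω => (1 + ε k - c k) * U k ω + δ k)
    (hεs : Summable ε) (hδs : Summable δ)
    (hcs : Tendsto (fun K => ∑ k ∈ Finset.range K, c k) atTop atTop) :
    Tendsto (fun k => ∫ ω, U k ω ∂μ) atTop (𝓝 0) ∧
      ∀ᵐ ω ∂μ, Tendsto (fun k => U k ω) atTop (𝓝 0) := by
  have hmean : Tendsto (fun k => ∫ ω, U k ω ∂μ) atTop (𝓝 0) := by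
    refine tendsto_zero_of_almost_contracting (fun k => integral_nonneg_of_ae (hU k)) hε hc hδ ?_
      hεs hδs hcs
    intro k
    rw [← integral_condExp (𝒢.le k)]
    calc ∫ ω, (μ[U (k + 1) | 𝒢 k]) ω ∂μ ≤ ∫ ω, ((1 + ε k - c k) * U k ω + δ k) ∂μ :=
          integral_mono_ae integrable_condExp
            (((hint k).const_mul _).add (integrable_const _)) (hstep k)
      _ = _ := by
        rw [integral_add ((hint k).const_mul _) (integrable_const _), integral_const_mul]
        simp
  refine ⟨hmean, ?_⟩
  set p : ℕ → ℝ := fun k => ∏ j ∈ Finset.range k, (1 + ε j) with hp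
  set M := Real.exp (∑' j, ε j)
  have hp1 : ∀ k, 1 ≤ p k := one_le_prod_one_add hε
  have hpM : ∀ k, p k ≤ M := prod_one_add_le_exp_tsum hε hεs
  have hp0 : ∀ k, 0 < p k := fun k => lt_of_lt_of_le one_pos (hp1 k)
  have hpsucc : ∀ k, p (k + 1) = p k * (1 + ε k) := fun k => Finset.prod_range_succ _ _
  -- Normalising by `p` and subtracting the accumulated `δ` yields a true supermartingale; the drift
  -- `c` is only needed for the mean.
  set V : ℕ → Ω → ℝ := fun k ω => (p k)⁻¹ * U k ω - ∑ j ∈ Finset.range k, δ j with hV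
  have hVint : ∀ k, Integrable (V k) μ := fun k =>
    ((hint k).const_mul _).sub (integrable_const _)
  have hsuper : Supermartingale V 𝒢 μ := by
    refine supermartingale_nat (fun k => ((hadp k).const_mul _).sub stronglyMeasurable_const)
      hVint fun k => ?_
    have h1 : μ[V (k + 1) | 𝒢 k] =ᵐ[μ]
        fun ω => (p (k + 1))⁻¹ * (μ[U (k + 1) | 𝒢 k]) ω - ∑ j ∈ Finset.range (k + 1), δ j := by
      have a := condExp_sub (μ := μ) ((hint (k + 1)).const_mul (p (k + 1))⁻¹)
        (integrable_const (∑ j ∈ Finset.range (k + 1), δ j)) (𝒢 k)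
      have b := condExp_smul (μ := μ) (p (k + 1))⁻¹ (U (k + 1)) (𝒢 k)
      rw [condExp_const (𝒢.le k)] at a
      filter_upwards [a, b] with ω ha hb
      refine ha.trans ?_
      simp only [Pi.sub_apply]
      congr 1
    filter_upwards [h1, hstep k, hU k] with ω h1 h2 h3
    rw [h1, hV]
    simp only [Pi.zero_apply] at h3
    have h4 : (p (k + 1))⁻¹ * (μ[U (k + 1) | 𝒢 k]) ω ≤ (p k)⁻¹ * U k ω + δ k := by
      rw [inv_mul_le_iff₀ (hp0 _)]
      have e1 : p (k + 1) * ((p k)⁻¹ * U k ω) = (1 + ε k) * U k ω := by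
        rw [hpsucc]; field_simp [(hp0 k).ne']
      have e2 : δ k ≤ p (k + 1) * δ k := le_mul_of_one_le_left (hδ k) (hp1 _)
      rw [mul_add, e1]
      nlinarith [mul_nonneg (hc k) h3]
    rw [Finset.sum_range_succ]
    linarith
  obtain ⟨B, hB⟩ := hmean.bddAbove_range
  -- Doob's theorem for the submartingale `-V`; the `L¹` bound comes from `|V k| ≤ U k + ∑ δ` and
  -- the bounded means of `U`.
  have hconv := hsuper.neg.exists_ae_tendsto_of_bdd (R := Real.toNNReal (B + ∑' j, δ j)) fun k => by
    have hVk : Integrable ((-V) k) μ := (hVint k).neg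
    rw [eLpNorm_one_eq_lintegral_enorm, ← ofReal_integral_norm_eq_lintegral_enorm hVk,
      ENNReal.ofNNReal_toNNReal]
    refine ENNReal.ofReal_le_ofReal ?_
    have hle : ∀ᵐ ω ∂μ, ‖(-V) k ω‖ ≤ U k ω + ∑' j, δ j := by
      filter_upwards [hU k] with ω h0
      simp only [Pi.zero_apply] at h0
      rw [Pi.neg_apply, Pi.neg_apply, norm_neg, hV]
      refine (norm_sub_le _ _).trans ?_
      have i1 : (p k)⁻¹ ≤ 1 := inv_le_one_of_one_le₀ (hp1 k)
      have i0 : 0 ≤ (p k)⁻¹ := inv_nonneg.2 (hp0 k).le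
      rw [Real.norm_of_nonneg (mul_nonneg i0 h0),
        Real.norm_of_nonneg (Finset.sum_nonneg fun j _ => hδ j)]
      have := hδs.sum_le_tsum (Finset.range k) fun k _ => hδ k
      nlinarith [mul_le_mul_of_nonneg_right i1 h0]
    calc ∫ ω, ‖(-V) k ω‖ ∂μ ≤ ∫ ω, (U k ω + ∑' j, δ j) ∂μ :=
          integral_mono_ae hVk.norm ((hint k).add (integrable_const _)) hle
      _ = ∫ ω, U k ω ∂μ + ∑' j, δ j := by
        rw [integral_add (hint k) (integrable_const _)]; simp
      _ ≤ _ := by linarith [hB ⟨k, rfl⟩]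
  -- Convergence in mean gives a subsequence tending to `0` almost surely, which identifies the
  -- almost sure limit of `U`.
  have hL1 : Tendsto (fun k => eLpNorm (U k - fun _ => (0 : ℝ)) 1 μ) atTop (𝓝 0) := by
    have : ∀ k, eLpNorm (U k - fun _ => (0 : ℝ)) 1 μ = ENNReal.ofReal (∫ ω, U k ω ∂μ) := by
      intro k
      have e : (U k - fun _ => (0 : ℝ)) = U k := by ext; simp
      rw [e, eLpNorm_one_eq_lintegral_enorm, ← ofReal_integral_norm_eq_lintegral_enorm (hint k)]
      congr 1
      refine integral_congr_ae ?_
      filter_upwards [hU k] with ω h0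
      exact Real.norm_of_nonneg h0
    simp_rw [this]
    rw [← ENNReal.ofReal_zero]
    exact (ENNReal.continuous_ofReal.tendsto 0).comp hmean
  obtain ⟨ns, hns, hsub⟩ := (tendstoInMeasure_of_tendsto_eLpNorm one_ne_zero
    (fun k => (hint k).aestronglyMeasurable) aestronglyMeasurable_const hL1).exists_seq_tendsto_ae
  have hpbdd : ∃ P, Tendsto p atTop (𝓝 P) := by
    refine ⟨_, tendsto_atTop_ciSup (monotone_nat_of_le_succ fun k => ?_) ⟨M, ?_⟩⟩
    · rw [hpsucc]; exact le_mul_of_one_le_right (hp0 k).le (by linarith [hε k])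
    · rintro _ ⟨k, rfl⟩; exact hpM k
  obtain ⟨P, hP⟩ := hpbdd
  filter_upwards [hconv, hsub] with ω ⟨l, hl⟩ h2
  have h3 : Tendsto (fun k => U k ω) atTop (𝓝 (P * (-l + ∑' j, δ j))) := by
    refine (hP.mul (hl.neg.add hδs.hasSum.tendsto_sum_nat)).congr fun k => ?_
    simp only [hV, Pi.neg_apply, neg_neg, sub_add_cancel]
    rw [mul_inv_cancel_left₀ (hp0 k).ne']
  have h4 := tendsto_nhds_unique (h3.comp hns.tendsto_atTop) h2
  rwa [h4] at h3

/-! ## The transition operator and the Poisson equation -/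

section Poisson

variable {S : Type*} {V : Type*} [NormedAddCommGroup V] [NormedSpace ℝ V]

/-- The transition operator of a stochastic matrix, acting on vector-valued functions. -/
noncomputable def transitionOp (P : S → S → ℝ) (φ : S → V) (s : S) : V := ∑' t, P s t • φ t

theorem summable_smul_of_bounded [CompleteSpace V] {p : S → ℝ} (hps : Summable fun s => |p s|)
    {φ : S → V} {C : ℝ} (hφ : ∀ s, ‖φ s‖ ≤ C) : Summable fun s => p s • φ s := by
  refine Summable.of_norm_bounded (hps.mul_right C) fun s => ?_
  rw [norm_smul, Real.norm_eq_abs]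
  exact mul_le_mul_of_nonneg_left (hφ s) (abs_nonneg _)

theorem norm_tsum_smul_le {p : S → ℝ} (hps : Summable fun s => |p s|)
    {φ : S → V} {C : ℝ} (hφ : ∀ s, ‖φ s‖ ≤ C) : ‖∑' s, p s • φ s‖ ≤ (∑' s, |p s|) * C := by
  rw [← tsum_mul_right]
  refine tsum_of_norm_bounded (hps.mul_right C).hasSum fun s => ?_
  rw [norm_smul, Real.norm_eq_abs]
  exact mul_le_mul_of_nonneg_left (hφ s) (abs_nonneg _)

variable {P : S → S → ℝ} (hP : IsTransitionMatrix P)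
include hP

theorem IsTransitionMatrix.summable_abs (s : S) : Summable fun t => |P s t| := by
  simpa only [abs_of_nonneg (hP.nonneg s _)] using (hP.hasSum_one s).summable

theorem IsTransitionMatrix.summable_mul {p : S → ℝ} (hp : ∀ s, 0 ≤ p s) (hps : Summable p) :
    Summable fun x : S × S => p x.1 * P x.1 x.2 := by
  have h0 : 0 ≤ fun x : S × S => p x.1 * P x.1 x.2 :=
    Pi.le_def.2 fun x => mul_nonneg (hp _) (hP.nonneg _ _)
  have h1 : ∀ u, HasSum (fun t => p u * P u t) (p u) := fun u => by
    simpa using (hP.hasSum_one u).mul_left (p u)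
  have h2 : (fun u => ∑' t, p u * P u t) = p := funext fun u => (h1 u).tsum_eq
  have h3 : Summable fun u => ∑' t, p u * P u t := by rw [h2]; exact hps
  exact (summable_prod_of_nonneg h0).2 ⟨fun u => (h1 u).summable, h3⟩

/-- Fubini: averaging `P φ` under `p` is averaging `φ` under `p P`. -/
theorem IsTransitionMatrix.tsum_smul_transitionOp [CompleteSpace V] {p : S → ℝ}
    (hp : ∀ s, 0 ≤ p s) (hps : Summable p) {φ : S → V} {C : ℝ} (hφ : ∀ s, ‖φ s‖ ≤ C) :
    ∑' u, p u • transitionOp P φ u = ∑' t, (∑' u, p u * P u t) • φ t := by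
  have h := hP.summable_mul hp hps
  have hs : Summable fun x : S × S => (p x.1 * P x.1 x.2) • φ x.2 :=
    summable_smul_of_bounded (φ := fun x : S × S => φ x.2) h.abs fun x => hφ x.2
  have hs' : Summable (Function.uncurry fun u t => (p u * P u t) • φ t) := hs
  have hcol : ∀ t, Summable fun u => p u * P u t := fun t =>
    h.comp_injective (i := fun u => (u, t)) fun a b hab => (Prod.ext_iff.1 hab).1
  calc ∑' u, p u • transitionOp P φ u = ∑' u, ∑' t, (p u * P u t) • φ t := by
        refine tsum_congr fun u => ?_
        rw [transitionOp, ← tsum_const_smul'' (p u)]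
        simp only [mul_smul]
    _ = ∑' t, ∑' u, (p u * P u t) • φ t := hs'.tsum_comm.symm
    _ = _ := tsum_congr fun t => ((hcol t).tsum_smul_const (φ t))

theorem IsTransitionMatrix.transitionPow (k : ℕ) : IsTransitionMatrix (transitionPow P k) := by
  induction k with
  | zero =>
    refine ⟨fun s t => ?_, fun s => ?_⟩
    · simp only [_root_.transitionPow]; split_ifs <;> norm_num
    · classical
      convert hasSum_ite_eq s (1 : ℝ) using 2 with t
      simp only [_root_.transitionPow, eq_comm]
  | succ k ih =>
    have hsum : ∀ s, Summable fun x : S × S => _root_.transitionPow P k s x.1 * P x.1 x.2 :=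
      fun s => hP.summable_mul (ih.nonneg s) (ih.hasSum_one s).summable
    refine ⟨fun s t => tsum_nonneg fun u => mul_nonneg (ih.nonneg _ _) (hP.nonneg _ _),
      fun s => ?_⟩
    have hswap := (hsum s).prod_symm
    have h1 : Summable fun t => ∑' u, _root_.transitionPow P k s u * P u t := hswap.prod
    -- Applied to `φ = 1`, this computes the row sums of the product.
    have h2 := hP.tsum_smul_transitionOp (ih.nonneg s) (ih.hasSum_one s).summable
      (φ := fun _ => (1 : ℝ)) (C := 1) (by simp)
    simp only [transitionOp, smul_eq_mul, mul_one, (hP.hasSum_one _).tsum_eq,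
      (ih.hasSum_one s).tsum_eq] at h2
    rw [h2]
    exact h1.hasSum

theorem IsTransitionMatrix.norm_transitionOp_le {φ : S → V} {C : ℝ}
    (hφ : ∀ s, ‖φ s‖ ≤ C) (s : S) : ‖transitionOp P φ s‖ ≤ C := by
  rw [transitionOp]
  have := norm_tsum_smul_le (hP.summable_abs s) hφ
  simpa only [abs_of_nonneg (hP.nonneg s _), (hP.hasSum_one s).tsum_eq, one_mul] using this

theorem IsTransitionMatrix.transitionOp_iterate [CompleteSpace V] (k : ℕ) {φ : S → V} {C : ℝ}
    (hφ : ∀ s, ‖φ s‖ ≤ C) (s : S) :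
    (transitionOp P)^[k] φ s = transitionOp (_root_.transitionPow P k) φ s := by
  induction k generalizing φ with
  | zero =>
    classical
    simp only [Function.iterate_zero, id, transitionOp, _root_.transitionPow]
    rw [tsum_eq_single s fun t ht => by simp [ht.symm]]
    simp
  | succ k ih =>
    rw [Function.iterate_succ_apply, ih (hP.norm_transitionOp_le hφ), transitionOp,
      hP.tsum_smul_transitionOp ((hP.transitionPow k).nonneg s)
        ((hP.transitionPow k).hasSum_one s).summable hφ]
    rfl

/-- The Poisson equation of a uniformly ergodic chain has a bounded solution. -/
theorem IsTransitionMatrix.exists_poisson [CompleteSpace V] {π : S → ℝ}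
    (hπ : IsStationaryDistribution P π) (herg : IsUniformlyErgodic P π) {φ : S → V} {C : ℝ}
    (hφ : ∀ s, ‖φ s‖ ≤ C) :
    ∃ (g : S → V) (K : ℝ), (∀ s, ‖g s‖ ≤ K) ∧
      ∀ s, g s - transitionOp P g s = φ s - ∑' t, π t • φ t := by
  obtain ⟨r, R, hr, hR, herg⟩ := herg
  set m := ∑' t, π t • φ t with hm
  have hπs : Summable fun t => |π t| := hπ.hasSum_one.summable.abs
  have hmC : ‖m‖ ≤ C := by
    have := norm_tsum_smul_le hπs hφ
    simpa only [abs_of_nonneg (hπ.nonneg _), hπ.hasSum_one.tsum_eq, one_mul] using this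
  set ψ : S → V := fun s => φ s - m with hψ
  have hψC : ∀ s, ‖ψ s‖ ≤ C + C := fun s => (norm_sub_le _ _).trans (add_le_add (hφ s) hmC)
  -- Rows of `P^k` sum to one, so centring `φ` by `m` turns the `k`-th iterate into an integral of
  -- `φ` against `P^k(s, ·) - π`, whose total mass decays geometrically.
  have hbound : ∀ k s, ‖(transitionOp P)^[k] ψ s‖ ≤ R * (r ^ k)⁻¹ * C := by
    intro k s
    have hk := hP.transitionPow k
    have e : (transitionOp P)^[k] ψ s
        = ∑' t, (_root_.transitionPow P k s t - π t) • φ t := by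
      rw [hP.transitionOp_iterate k hψC, transitionOp]
      simp only [hψ, smul_sub, sub_smul]
      rw [(summable_smul_of_bounded (hk.summable_abs s) hφ).tsum_sub
        ((hk.hasSum_one s).summable.smul_const m),
        (hk.hasSum_one s).summable.tsum_smul_const, (hk.hasSum_one s).tsum_eq, one_smul,
        (summable_smul_of_bounded (hk.summable_abs s) hφ).tsum_sub
        (summable_smul_of_bounded hπs hφ)]
    rw [e]
    have hs : Summable fun t => |_root_.transitionPow P k s t - π t| :=
      ((hk.hasSum_one s).summable.sub hπ.hasSum_one.summable).abs
    exact (norm_tsum_smul_le hs hφ).trans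
      (mul_le_mul_of_nonneg_right (herg k s) ((norm_nonneg _).trans (hφ s)))
  have hgeom : Summable fun k : ℕ => R * (r ^ k)⁻¹ * C := by
    refine Summable.mul_right _ (Summable.mul_left _ ?_)
    simpa only [inv_pow] using
      summable_geometric_of_lt_one (inv_nonneg.2 (zero_lt_one.trans hr).le) (inv_lt_one_of_one_lt₀ hr)
  have hsum : ∀ s, Summable fun k => (transitionOp P)^[k] ψ s := fun s =>
    Summable.of_norm_bounded hgeom fun k => hbound k s
  -- The Neumann series `∑ P^k ψ`: applying `P` shifts it by one index, so `g - P g` is its zeroth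
  -- term `ψ`.
  refine ⟨fun s => ∑' k, (transitionOp P)^[k] ψ s, ∑' k : ℕ, R * (r ^ k)⁻¹ * C,
    fun s => tsum_of_norm_bounded hgeom.hasSum fun k => hbound k s, fun s => ?_⟩
  have hswap : transitionOp P (fun s => ∑' k, (transitionOp P)^[k] ψ s) s
      = ∑' k, (transitionOp P)^[k + 1] ψ s := by
    rw [transitionOp]
    have h2 : Summable (Function.uncurry fun t k => P s t • (transitionOp P)^[k] ψ t) := by
      refine Summable.of_norm_bounded (g := fun x : S × ℕ => P s x.1 * (R * (r ^ x.2)⁻¹ * C))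
        ?_ ?_
      · exact Summable.mul_of_nonneg (hP.hasSum_one s).summable hgeom (hP.nonneg s)
          fun k => (norm_nonneg _).trans (hbound k s)
      · rintro ⟨t, k⟩
        simp only [Function.uncurry, norm_smul, Real.norm_of_nonneg (hP.nonneg s t)]
        exact mul_le_mul_of_nonneg_left (hbound k t) (hP.nonneg s t)
    calc ∑' t, P s t • ∑' k, (transitionOp P)^[k] ψ t
        = ∑' t, ∑' k, P s t • (transitionOp P)^[k] ψ t :=
          tsum_congr fun t => (tsum_const_smul'' (P s t)).symm
      _ = ∑' k, ∑' t, P s t • (transitionOp P)^[k] ψ t := h2.tsum_comm.symm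
      _ = _ := tsum_congr fun k => by
        rw [Function.iterate_succ_apply']
        rfl
  rw [hswap]
  simp only []
  rw [(hsum s).tsum_eq_zero_add]
  simp [hψ]

end Poisson

/-! ## Conditional expectations: independent enlargement and the Markov property -/

section CondExp

variable {Ω : Type*} {V : Type*} [NormedAddCommGroup V] [NormedSpace ℝ V] [CompleteSpace V]

theorem isPiSystem_inter_measurableSet (m₁ m₂ : MeasurableSpace Ω) :
    IsPiSystem {s | ∃ A B, MeasurableSet[m₁] A ∧ MeasurableSet[m₂] B ∧ s = A ∩ B} := by
  rintro _ ⟨A, B, hA, hB, rfl⟩ _ ⟨A', B', hA', hB', rfl⟩ -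
  exact ⟨A ∩ A', B ∩ B', hA.inter hA', hB.inter hB', Set.inter_inter_inter_comm _ _ _ _⟩

theorem sup_eq_generateFrom_inter (m₁ m₂ : MeasurableSpace Ω) :
    m₁ ⊔ m₂ = MeasurableSpace.generateFrom
      {s | ∃ A B, MeasurableSet[m₁] A ∧ MeasurableSet[m₂] B ∧ s = A ∩ B} := by
  refine le_antisymm (sup_le ?_ ?_) (MeasurableSpace.generateFrom_le ?_)
  · exact fun A hA => MeasurableSpace.measurableSet_generateFrom
      ⟨A, Set.univ, hA, MeasurableSet.univ, (Set.inter_univ A).symm⟩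
  · exact fun B hB => MeasurableSpace.measurableSet_generateFrom
      ⟨Set.univ, B, MeasurableSet.univ, hB, (Set.univ_inter B).symm⟩
  · rintro _ ⟨A, B, hA, hB, rfl⟩
    have h1 : m₁ ≤ m₁ ⊔ m₂ := le_sup_left
    have h2 : m₂ ≤ m₁ ⊔ m₂ := le_sup_right
    exact (h1 _ hA).inter (h2 _ hB)

/-- The function `A.indicator f` is `m₂`-measurable, so its conditional expectation given the
independent `m₁` is constant. -/
theorem setIntegral_inter_of_indep {m₁ m₂ m0 : MeasurableSpace Ω} {μ : Measure Ω}
    [IsProbabilityMeasure μ] (h₁ : m₁ ≤ m0) (h₂ : m₂ ≤ m0) (hind : Indep m₂ m₁ μ)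
    {f : Ω → V} (hf : StronglyMeasurable[m₂] f) (hfi : Integrable f μ) {A B : Set Ω}
    (hA : MeasurableSet[m₂] A) (hB : MeasurableSet[m₁] B) :
    ∫ ω in A ∩ B, f ω ∂μ = μ.real B • ∫ ω in A, f ω ∂μ := by
  have hAi : Integrable (A.indicator f) μ := hfi.indicator (h₂ _ hA)
  have h := condExp_indep_eq h₂ h₁ (hf.indicator hA) hind
  calc ∫ ω in A ∩ B, f ω ∂μ = ∫ ω in B, A.indicator f ω ∂μ := by
        rw [setIntegral_indicator (h₂ _ hA), Set.inter_comm]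
    _ = ∫ ω in B, (μ[A.indicator f | m₁]) ω ∂μ := (setIntegral_condExp h₁ hAi hB).symm
    _ = ∫ _ in B, (∫ x, A.indicator f x ∂μ) ∂μ :=
        setIntegral_congr_ae (h₁ _ hB) (h.mono fun ω hω _ => hω)
    _ = _ := by rw [setIntegral_const, integral_indicator (h₂ _ hA)]

/-- Enlarging the conditioning sigma-algebra by an independent one changes nothing. -/
theorem condExp_sup_of_indep {m₁ m₂ n m0 : MeasurableSpace Ω} {μ : Measure Ω}
    [IsProbabilityMeasure μ] (h₁ : m₁ ≤ m0) (h₂ : m₂ ≤ m0) (hn : n ≤ m₂) (hind : Indep m₂ m₁ μ)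
    {f : Ω → V} (hf : StronglyMeasurable[m₂] f) (hfi : Integrable f μ) :
    μ[f | n ⊔ m₁] =ᵐ[μ] μ[f | n] := by
  have hn0 : n ≤ m0 := hn.trans h₂
  have hsup : n ⊔ m₁ ≤ m0 := sup_le hn0 h₁
  refine (ae_eq_condExp_of_forall_setIntegral_eq hsup hfi
    (fun s _ _ => integrable_condExp.integrableOn) (fun s hs _ => ?_)
    (stronglyMeasurable_condExp.mono (le_sup_left : n ≤ n ⊔ m₁)).aestronglyMeasurable).symm
  -- A π-λ argument: on `A ∩ B` with `A` in `n` and `B` in `m₁`, both integrals factor out `μ.real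
  -- B`, and the remaining integrals over `A` agree.
  have key : ∀ s, MeasurableSet[n ⊔ m₁] s → ∫ ω in s, (μ[f | n]) ω ∂μ = ∫ ω in s, f ω ∂μ := by
    refine MeasurableSpace.induction_on_inter (m := n ⊔ m₁) (sup_eq_generateFrom_inter n m₁)
      (isPiSystem_inter_measurableSet n m₁) (by simp) ?_ ?_ ?_
    · rintro _ ⟨A, B, hA, hB, rfl⟩
      rw [setIntegral_inter_of_indep h₁ h₂ hind hf hfi (hn _ hA) hB,
        setIntegral_inter_of_indep h₁ h₂ hind (stronglyMeasurable_condExp.mono hn)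
          integrable_condExp (hn _ hA) hB, setIntegral_condExp hn0 hfi hA]
    · intro t ht ih
      have e1 := integral_add_compl (hsup _ ht) (integrable_condExp (μ := μ) (f := f) (m := n))
      have e2 := integral_add_compl (hsup _ ht) hfi
      rw [integral_condExp hn0, ← e2, ih] at e1
      exact add_left_cancel e1
    · intro t hd ht ih
      rw [integral_iUnion (fun i => hsup _ (ht i)) hd integrable_condExp.integrableOn,
        integral_iUnion (fun i => hsup _ (ht i)) hd hfi.integrableOn]
      exact tsum_congr ih
  exact key s hs

/-- The sigma-algebra generated by the variables at the times `0, …, k - 1`. -/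
abbrev histSigma {α : Type*} [MeasurableSpace α] (X : ℕ → Ω → α) (k : ℕ) : MeasurableSpace Ω :=
  ⨆ j : ℕ, ⨆ _ : j < k, MeasurableSpace.comap (X j) inferInstance

theorem histSigma_mono {α : Type*} [MeasurableSpace α] (X : ℕ → Ω → α) {k l : ℕ} (h : k ≤ l) :
    histSigma X k ≤ histSigma X l :=
  iSup_mono fun _ => iSup_mono' fun hj => ⟨hj.trans_le h, le_rfl⟩

theorem histSigma_le {α : Type*} [MeasurableSpace α] {m0 : MeasurableSpace Ω} {X : ℕ → Ω → α}
    (hX : ∀ k, Measurable (X k)) (k : ℕ) : histSigma X k ≤ m0 :=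
  iSup₂_le fun j _ => (hX j).comap_le

theorem comap_le_histSigma {α : Type*} [MeasurableSpace α] (X : ℕ → Ω → α) {j k : ℕ}
    (h : j < k) : MeasurableSpace.comap (X j) inferInstance ≤ histSigma X k :=
  le_iSup₂_of_le j h le_rfl

theorem measurable_histSigma {α : Type*} [MeasurableSpace α] (X : ℕ → Ω → α) {j k : ℕ}
    (h : j < k) : Measurable[histSigma X k] (X j) :=
  measurable_iff_comap_le.2 (comap_le_histSigma X h)

theorem histSigma_eq_comap {α : Type*} [MeasurableSpace α] (X : ℕ → Ω → α) (k : ℕ) :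
    histSigma X k =
      MeasurableSpace.comap (fun ω (j : Fin k) => X j ω) inferInstance := by
  refine le_antisymm (iSup₂_le fun j hj => ?_) ?_
  · rw [← measurable_iff_comap_le]
    have h : Measurable[MeasurableSpace.comap (fun ω (j : Fin k) => X j ω) inferInstance]
        (fun ω (j : Fin k) => X j ω) := comap_measurable _
    exact (measurable_pi_apply (⟨j, hj⟩ : Fin k)).comp h
  · let := histSigma X k
    rw [← measurable_iff_comap_le]
    exact measurable_pi_iff.2 fun j => measurable_histSigma X j.2

theorem histSigma_le_comap {α : Type*} [MeasurableSpace α] (X : ℕ → Ω → α) (k : ℕ) :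
    histSigma X k ≤ MeasurableSpace.comap (fun ω j => X j ω) inferInstance := by
  refine iSup₂_le fun j _ => ?_
  rw [← measurable_iff_comap_le]
  exact (measurable_pi_apply j).comp (comap_measurable fun ω j => X j ω)

variable {S : Type*} [Countable S] [MeasurableSpace S] [DiscreteMeasurableSpace S]

omit [NormedSpace ℝ V] [CompleteSpace V] in
theorem integrable_comp_of_bounded [m0 : MeasurableSpace Ω] {μ : Measure Ω}
    [IsFiniteMeasure μ] {Y : Ω → S} (hY : Measurable Y) {g : S → V} {C : ℝ}
    (hg : ∀ s, ‖g s‖ ≤ C) : Integrable (fun ω => g (Y ω)) μ :=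
  Integrable.of_bound (StronglyMeasurable.of_discrete.comp_measurable hY).aestronglyMeasurable C
    (ae_of_all _ fun _ => hg _)

/-- The Markov property with respect to the chain's own history. -/
theorem condExp_markov [m0 : MeasurableSpace Ω] {μ : Measure Ω} [IsProbabilityMeasure μ]
    {P : S → S → ℝ} (hP : IsTransitionMatrix P) {Y : ℕ → Ω → S} (hY : ∀ k, Measurable (Y k))
    (hmarkov : ∀ (k : ℕ) (p : ℕ → S), μ.real {ω | ∀ i ≤ k + 1, Y i ω = p i} =
      μ.real {ω | ∀ i ≤ k, Y i ω = p i} * P (p k) (p (k + 1)))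
    {g : S → V} {C : ℝ} (hg : ∀ s, ‖g s‖ ≤ C) (k : ℕ) :
    μ[fun ω => g (Y (k + 1) ω) | histSigma Y (k + 1)]
      =ᵐ[μ] fun ω => transitionOp P g (Y k ω) := by
  have hle := histSigma_le (m0 := m0) hY (k + 1)
  have hgi := integrable_comp_of_bounded (μ := μ) (hY (k + 1)) hg
  have hTi := integrable_comp_of_bounded (μ := μ) (hY k) (hP.norm_transitionOp_le hg)
  refine (ae_eq_condExp_of_forall_setIntegral_eq hle hgi (fun s _ _ => hTi.integrableOn) ?_
    ((StronglyMeasurable.of_discrete (f := transitionOp P g)).comp_measurable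
      (measurable_histSigma Y k.lt_succ_self)).aestronglyMeasurable).symm
  intro s hs _
  rw [histSigma_eq_comap] at hs
  obtain ⟨D, -, rfl⟩ := hs
  set path : Ω → Fin (k + 1) → S := fun ω j => Y j ω with hpath
  have hpm : Measurable path := measurable_pi_iff.2 fun j => hY j
  -- There are countably many finite paths, so every event of the history is a countable union of
  -- atoms and the identity need only be checked on each atom.
  have hU : path ⁻¹' D = ⋃ p : D, path ⁻¹' {p.1} := by ext ω; simp
  have hm : ∀ p : D, MeasurableSet (path ⁻¹' {p.1}) := fun p =>
    hpm (measurableSet_singleton p.1)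
  have hd : Pairwise (Function.onFun Disjoint fun p : D => path ⁻¹' {p.1}) := fun p q hpq =>
    Disjoint.preimage _ (Set.disjoint_singleton.2 fun h => hpq (Subtype.ext h))
  rw [hU, integral_iUnion hm hd hTi.integrableOn, integral_iUnion hm hd hgi.integrableOn]
  refine tsum_congr fun p => ?_
  set B := path ⁻¹' {p.1} with hB
  have hpk : ∀ ω ∈ B, Y k ω = p.1 (Fin.last k) := fun ω hω => by
    rw [← show path ω = p.1 from hω]
    simp [hpath]
  have hq : ∀ t, μ.real (Y (k + 1) ⁻¹' {t} ∩ B) = μ.real B * P (p.1 (Fin.last k)) t := by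
    intro t
    -- The finite path is extended by the constant `t`; only its value at time `k + 1` matters.
    have h := hmarkov k fun i => if h : i < k + 1 then p.1 ⟨i, h⟩ else t
    have hB' : {ω | ∀ i ≤ k, Y i ω = if h : i < k + 1 then p.1 ⟨i, h⟩ else t} = B := by
      ext ω
      simp only [Set.mem_ofPred_eq, hB, Set.mem_preimage, Set.mem_singleton_iff, hpath, funext_iff]
      refine ⟨fun h j => ?_, fun h i hi => ?_⟩
      · have := h j (Nat.lt_succ_iff.1 j.2)
        rwa [dif_pos j.2] at this
      · rw [dif_pos (Nat.lt_succ_of_le hi)]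
        exact h ⟨i, Nat.lt_succ_of_le hi⟩
    have hB'' : {ω | ∀ i ≤ k + 1, Y i ω = if h : i < k + 1 then p.1 ⟨i, h⟩ else t}
        = Y (k + 1) ⁻¹' {t} ∩ B := by
      rw [← hB']
      ext ω
      simp only [Set.mem_ofPred_eq, Set.mem_inter_iff, Set.mem_preimage, Set.mem_singleton_iff]
      refine ⟨fun h => ⟨?_, fun i hi => h i (hi.trans k.le_succ)⟩, fun h i hi => ?_⟩
      · simpa using h (k + 1) le_rfl
      · rcases Nat.le_succ_iff.1 hi with hi | rfl
        · exact h.2 i hi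
        · simpa using h.1
    rw [hB', hB''] at h
    rw [h, dif_pos k.lt_succ_self, dif_neg (lt_irrefl _)]
    rfl
  have hl : ∫ ω in B, transitionOp P g (Y k ω) ∂μ
      = μ.real B • transitionOp P g (p.1 (Fin.last k)) := by
    rw [setIntegral_congr_fun (hm p) (g := fun _ => transitionOp P g (p.1 (Fin.last k)))
      fun ω hω => by simp only [hpk ω hω], setIntegral_const]
  have hr : ∫ ω in B, g (Y (k + 1) ω) ∂μ
      = ∑' t, μ.real (Y (k + 1) ⁻¹' {t} ∩ B) • g t := by
    have : IsFiniteMeasure ((μ.restrict B).map (Y (k + 1))) :=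
      Measure.isFiniteMeasure_map _ _
    have hsm : StronglyMeasurable g := StronglyMeasurable.of_discrete
    rw [← integral_map (hY (k + 1)).aemeasurable hsm.aestronglyMeasurable,
      integral_countable (Integrable.of_bound hsm.aestronglyMeasurable C (ae_of_all _ hg))]
    refine tsum_congr fun t => ?_
    rw [map_measureReal_apply (hY (k + 1)) (measurableSet_singleton t),
      measureReal_restrict_apply (hY (k + 1) (measurableSet_singleton t))]
  rw [hl, hr]
  simp only [hq, mul_smul]
  exact (tsum_const_smul'' _).symm

/-- The Markov property with respect to an independently enlarged history. -/
theorem condExp_markov_sup {n : MeasurableSpace Ω} [m0 : MeasurableSpace Ω] {μ : Measure Ω}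
    [IsProbabilityMeasure μ] {P : S → S → ℝ} (hP : IsTransitionMatrix P) {Y : ℕ → Ω → S}
    (hY : ∀ k, Measurable (Y k))
    (hmarkov : ∀ (k : ℕ) (p : ℕ → S), μ.real {ω | ∀ i ≤ k + 1, Y i ω = p i} =
      μ.real {ω | ∀ i ≤ k, Y i ω = p i} * P (p k) (p (k + 1)))
    {g : S → V} {C : ℝ} (hg : ∀ s, ‖g s‖ ≤ C) (k : ℕ) (hn : n ≤ m0)
    (hind : Indep (MeasurableSpace.comap (fun ω j => Y j ω) inferInstance) n μ) :
    μ[fun ω => g (Y (k + 1) ω) | histSigma Y (k + 1) ⊔ n]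
      =ᵐ[μ] fun ω => transitionOp P g (Y k ω) := by
  have hYk : Measurable[MeasurableSpace.comap (fun ω j => Y j ω) inferInstance] (Y (k + 1)) :=
    (measurable_pi_apply (k + 1)).comp (comap_measurable fun ω j => Y j ω)
  exact (condExp_sup_of_indep hn (measurable_pi_iff.2 hY).comap_le
    (histSigma_le_comap Y (k + 1)) hind
    ((StronglyMeasurable.of_discrete (f := g)).comp_measurable hYk)
    (integrable_comp_of_bounded (μ := μ) (hY (k + 1)) hg)).trans
      (condExp_markov hP hY hmarkov hg k)

end CondExp

/-! ## Linear stochastic approximation driven by a Markov chain -/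

section StochasticApproximation

variable {E : Type*} [NormedAddCommGroup E] [InnerProductSpace ℝ E]

theorem abs_inner_apply_le {M : E →L[ℝ] E} {q : ℝ} (hM : ‖M‖ ≤ q) (x y : E) :
    |inner ℝ x (M y)| ≤ q * (‖x‖ * ‖y‖) := by
  calc |inner ℝ x (M y)| ≤ ‖x‖ * ‖M y‖ := abs_real_inner_le_norm _ _
    _ ≤ ‖x‖ * (q * ‖y‖) := by
      gcongr
      exact M.le_of_opNorm_le hM y
    _ = _ := by ring

/-- The perturbed Lyapunov function. -/
noncomputable def lyapunov (M : E →L[ℝ] E) (x : E) : ℝ := ‖x‖ ^ 2 - 2 * inner ℝ x (M x)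

theorem abs_lyapunov_sub_le {M : E →L[ℝ] E} {q : ℝ} (hM : ‖M‖ ≤ q) (x : E) :
    |lyapunov M x - ‖x‖ ^ 2| ≤ 2 * q * ‖x‖ ^ 2 := by
  have := abs_inner_apply_le hM x x
  rw [lyapunov, sub_sub_cancel_left, abs_neg, abs_mul, abs_two]
  nlinarith

/-- The corrector at work: expanding to first order, `-2⟪x, D x⟫ - 2⟪x, M x⟫` equals `-2⟪x, D' x⟫ -
2⟪x, Γ x⟫ - 2⟪x, (M - Γ') x⟫`. The `Γ` term rebuilds `lyapunov Γ x`, the last one costs `2 * Δ`, and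
the higher-order terms total at most `(1 + 2 + 2 + 1/2) * b ^ 2`, rounded up to `6 * b ^ 2`. -/
theorem lyapunov_step_le {D D' Γ Γ' M : E →L[ℝ] E} {b Δ c : ℝ} (hb : b ≤ 1 / 4)
    (hD : ‖D‖ ≤ b) (hM : ‖M‖ ≤ b) (hMΓ : ‖M - Γ'‖ ≤ Δ) (hdec : D = D' + Γ - Γ')
    (x : E) (hcoer : c * ‖x‖ ^ 2 ≤ inner ℝ x (D' x)) :
    lyapunov M (x - D x) ≤ lyapunov Γ x - 2 * c * ‖x‖ ^ 2 + (6 * b ^ 2 + 2 * Δ) * ‖x‖ ^ 2 := by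
  have hb0 : 0 ≤ b := (norm_nonneg _).trans hD
  have hDx : ‖D x‖ ≤ b * ‖x‖ := D.le_of_opNorm_le hD x
  have hx := norm_nonneg x
  have e1 : ‖x - D x‖ ^ 2 = ‖x‖ ^ 2 - 2 * inner ℝ x (D x) + ‖D x‖ ^ 2 := norm_sub_sq_real _ _
  have e2 : inner ℝ (x - D x) (M (x - D x)) = inner ℝ x (M x) - inner ℝ x (M (D x))
      - inner ℝ (D x) (M x) + inner ℝ (D x) (M (D x)) := by
    simp only [map_sub, inner_sub_left, inner_sub_right]; ring
  have e3 : inner ℝ x (D x) = inner ℝ x (D' x) + inner ℝ x (Γ x) - inner ℝ x (Γ' x) := by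
    simp [hdec, inner_add_right, inner_sub_right]
  have e4 : inner ℝ x ((M - Γ') x) = inner ℝ x (M x) - inner ℝ x (Γ' x) := by
    simp [inner_sub_right]
  have i1 : ‖D x‖ ^ 2 ≤ b ^ 2 * ‖x‖ ^ 2 := by
    rw [← mul_pow]; exact pow_le_pow_left₀ (norm_nonneg _) hDx 2
  have i2 : inner ℝ x (M (D x)) ≤ b ^ 2 * ‖x‖ ^ 2 := by
    refine (le_abs_self _).trans ((abs_inner_apply_le hM x (D x)).trans ?_)
    calc b * (‖x‖ * ‖D x‖) ≤ b * (‖x‖ * (b * ‖x‖)) := by gcongr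
      _ = _ := by ring
  have i3 : inner ℝ (D x) (M x) ≤ b ^ 2 * ‖x‖ ^ 2 := by
    refine (le_abs_self _).trans ((abs_inner_apply_le hM (D x) x).trans ?_)
    calc b * (‖D x‖ * ‖x‖) ≤ b * ((b * ‖x‖) * ‖x‖) := by gcongr
      _ = _ := by ring
  have i4 : -inner ℝ (D x) (M (D x)) ≤ b ^ 2 * ‖x‖ ^ 2 / 4 := by
    refine (neg_le_abs _).trans ((abs_inner_apply_le hM (D x) (D x)).trans ?_)
    calc b * (‖D x‖ * ‖D x‖) = b * ‖D x‖ ^ 2 := by ring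
      _ ≤ 1 / 4 * (b ^ 2 * ‖x‖ ^ 2) := by gcongr
      _ = _ := by ring
  have i5 : -inner ℝ x ((M - Γ') x) ≤ Δ * ‖x‖ ^ 2 := by
    refine (neg_le_abs _).trans ((abs_inner_apply_le hMΓ x x).trans (le_of_eq ?_))
    ring
  rw [lyapunov, lyapunov, e1, e2, e3]
  rw [e4] at i5
  have : 0 ≤ b ^ 2 * ‖x‖ ^ 2 := by positivity
  nlinarith

/-- The functional collecting the terms of `lyapunov M (y + w)` that are linear in `w`. -/
noncomputable def lyapunovCross (M : E →L[ℝ] E) (y : E) : E →L[ℝ] ℝ :=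
  (2 : ℝ) • (innerSL ℝ y - innerSL ℝ y ∘L M - innerSL ℝ (M y))

theorem lyapunovCross_apply (M : E →L[ℝ] E) (y w : E) :
    lyapunovCross M y w = 2 * (inner ℝ y w - inner ℝ y (M w) - inner ℝ (M y) w) := rfl

theorem stronglyMeasurable_clm_apply {Ω : Type*} {m : MeasurableSpace Ω} {F G : Type*}
    [NormedAddCommGroup F] [NormedSpace ℝ F] [NormedAddCommGroup G] [NormedSpace ℝ G]
    {M : Ω → F →L[ℝ] G} {x : Ω → F} (hM : StronglyMeasurable M) (hx : StronglyMeasurable x) :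
    StronglyMeasurable fun ω => M ω (x ω) :=
  isBoundedBilinearMap_apply.continuous.comp_stronglyMeasurable (hM.prodMk hx)

theorem stronglyMeasurable_lyapunovCross {Ω : Type*} {m : MeasurableSpace Ω}
    {M : Ω → E →L[ℝ] E} {y : Ω → E} (hM : StronglyMeasurable M) (hy : StronglyMeasurable y) :
    StronglyMeasurable fun ω => lyapunovCross (M ω) (y ω) := by
  have h1 : StronglyMeasurable fun ω => innerSL ℝ (y ω) :=
    (innerSL ℝ).continuous.comp_stronglyMeasurable hy
  have h2 : StronglyMeasurable fun ω => innerSL ℝ (M ω (y ω)) :=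
    (innerSL ℝ).continuous.comp_stronglyMeasurable (stronglyMeasurable_clm_apply hM hy)
  have h3 : StronglyMeasurable fun ω => innerSL ℝ (y ω) ∘L M ω :=
    stronglyMeasurable_clm_apply
      ((ContinuousLinearMap.compL ℝ E E ℝ).continuous.comp_stronglyMeasurable h1) hM
  exact ((h1.sub h3).sub h2).const_smul (2 : ℝ)

theorem lyapunov_add_le {M : E →L[ℝ] E} (hM : ‖M‖ ≤ 1 / 4) (y w : E) (a : ℝ) :
    lyapunov M (y + a • w) ≤ lyapunov M y
      + a * lyapunovCross M y w
      + 2 * a ^ 2 * ‖w‖ ^ 2 := by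
  have h := abs_le.1 (abs_inner_apply_le hM w w)
  have e1 : ‖y + a • w‖ ^ 2 = ‖y‖ ^ 2 + 2 * (a * inner ℝ y w) + a ^ 2 * ‖w‖ ^ 2 := by
    rw [norm_add_sq_real, inner_smul_right, norm_smul, mul_pow, Real.norm_eq_abs, sq_abs]
  have e2 : inner ℝ (y + a • w) (M (y + a • w)) = inner ℝ y (M y) + a * inner ℝ y (M w)
      + a * inner ℝ (M y) w + a ^ 2 * inner ℝ w (M w) := by
    simp only [map_add, map_smul, inner_add_left, inner_add_right, inner_smul_left,
      inner_smul_right, real_inner_comm w (M y)]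
    simp
    ring
  rw [lyapunov, lyapunov, e1, e2, lyapunovCross_apply]
  nlinarith [mul_le_mul_of_nonneg_left h.1 (sq_nonneg a), mul_nonneg (sq_nonneg a) (sq_nonneg ‖w‖)]

theorem integrable_lyapunov {Ω : Type*} {m : MeasurableSpace Ω} {μ : Measure Ω}
    {M : Ω → E →L[ℝ] E} {x : Ω → E} {q : ℝ} (hM : StronglyMeasurable M) (hMq : ∀ ω, ‖M ω‖ ≤ q)
    (hx : StronglyMeasurable x) (hx2 : MemLp x 2 μ) :
    Integrable (fun ω => inner ℝ (x ω) (M ω (x ω))) μ ∧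
      Integrable (fun ω => lyapunov (M ω) (x ω)) μ := by
  have h : Integrable (fun ω => inner ℝ (x ω) (M ω (x ω))) μ := by
    refine (hx2.integrable_norm_pow two_ne_zero |>.const_mul q).mono'
      (hx.inner (stronglyMeasurable_clm_apply hM hx)).aestronglyMeasurable (ae_of_all _ fun ω => ?_)
    refine (abs_inner_apply_le (hMq ω) _ _).trans (le_of_eq ?_)
    ring
  exact ⟨h, (hx2.integrable_norm_pow two_ne_zero).sub (h.const_mul 2)⟩

theorem condExp_clm_apply {Ω : Type*} {m m0 : MeasurableSpace Ω} {μ : Measure Ω} {F G : Type*}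
    [NormedAddCommGroup F] [NormedSpace ℝ F] [CompleteSpace F] [NormedAddCommGroup G]
    [NormedSpace ℝ G] [CompleteSpace G] {ℓ : Ω → F →L[ℝ] G} {g : Ω → F}
    (hℓ : StronglyMeasurable[m] ℓ) (hℓg : Integrable (fun ω => ℓ ω (g ω)) μ)
    (hg : Integrable g μ) : μ[fun ω => ℓ ω (g ω) | m] =ᵐ[μ] fun ω => ℓ ω (μ[g | m] ω) :=
  condExp_bilin_of_stronglyMeasurable_left (ContinuousLinearMap.id ℝ (F →L[ℝ] G)) hℓ hℓg hg

/-- For known `x` the form `⟪x, Γ x⟫` is linear in `Γ`, so conditioning replaces the random operator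
`Γ` by its conditional mean `M`. -/
theorem condExp_lyapunov_eq [CompleteSpace E] {Ω : Type*} {F m0 : MeasurableSpace Ω}
    {μ : Measure Ω} [IsProbabilityMeasure μ] (hF : F ≤ m0)
    {Γ M : Ω → E →L[ℝ] E} {x : Ω → E} {b : ℝ}
    (hΓ : ∀ ω, ‖Γ ω‖ ≤ b) (hΓm : StronglyMeasurable[m0] Γ) (hxm : StronglyMeasurable[F] x)
    (hx2 : MemLp x 2 μ) (hmarkov : μ[Γ | F] =ᵐ[μ] M) :
    μ[fun ω => lyapunov (Γ ω) (x ω) | F] =ᵐ[μ] fun ω => lyapunov (M ω) (x ω) := by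
  have hsq := hx2.integrable_norm_pow two_ne_zero
  have hΓint : Integrable Γ μ := Integrable.of_bound hΓm.aestronglyMeasurable b (ae_of_all _ hΓ)
  obtain ⟨hq, -⟩ := integrable_lyapunov hΓm hΓ (hxm.mono hF) hx2
  set ℓ : Ω → (E →L[ℝ] E) →L[ℝ] ℝ := fun ω =>
    innerSL ℝ (x ω) ∘L ContinuousLinearMap.apply ℝ E (x ω) with hℓ
  have hℓm : StronglyMeasurable[F] ℓ := by
    have hcont : Continuous fun z : E =>
        (innerSL ℝ z ∘L ContinuousLinearMap.apply ℝ E z : (E →L[ℝ] E) →L[ℝ] ℝ) := by fun_prop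
    exact hcont.comp_stronglyMeasurable hxm
  have hquad : μ[fun ω => inner ℝ (x ω) (Γ ω (x ω)) | F]
      =ᵐ[μ] fun ω => inner ℝ (x ω) (M ω (x ω)) := by
    have hq' : Integrable (fun ω => ℓ ω (Γ ω)) μ := hq
    have := condExp_clm_apply hℓm hq' hΓint
    filter_upwards [this, hmarkov] with ω h1 h2
    rw [h2] at h1
    exact h1
  have s1 := condExp_sub (μ := μ) hsq (hq.const_mul 2) F
  have s2 := condExp_smul (μ := μ) (2 : ℝ) (fun ω => inner ℝ (x ω) (Γ ω (x ω))) F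
  have s3 : μ[fun ω => ‖x ω‖ ^ 2 | F] = fun ω => ‖x ω‖ ^ 2 :=
    condExp_of_stronglyMeasurable hF (hxm.norm.pow 2) hsq
  rw [s3] at s1
  filter_upwards [s1, s2, hquad] with ω h1 h2 h3
  refine h1.trans ?_
  simp only [Pi.sub_apply, lyapunov]
  congr 1
  refine h2.trans ?_
  simp [h3]

/-- The part linear in the noise has a `𝒢`-measurable coefficient, hence zero conditional mean; only
the quadratic part survives. -/
theorem condExp_lyapunov_add_le [CompleteSpace E] {Ω : Type*} {𝒢 m0 : MeasurableSpace Ω}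
    {μ : Measure Ω} [IsProbabilityMeasure μ] (h𝒢 : 𝒢 ≤ m0)
    {M : Ω → E →L[ℝ] E} {y w : Ω → E} {a β : ℝ} (hM : ∀ ω, ‖M ω‖ ≤ 1 / 4)
    (hMm : StronglyMeasurable[𝒢] M) (hym : StronglyMeasurable[𝒢] y) (hy2 : MemLp y 2 μ)
    (hwm : StronglyMeasurable[m0] w) (hw2 : MemLp w 2 μ)
    (hw0 : μ[w | 𝒢] =ᵐ[μ] 0) (hwβ : μ[fun ω => ‖w ω‖ ^ 2 | 𝒢] ≤ᵐ[μ] fun _ => β) :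
    μ[fun ω => lyapunov (M ω) (y ω + a • w ω) | 𝒢] ≤ᵐ[μ]
      fun ω => lyapunov (M ω) (y ω) + 2 * a ^ 2 * β := by
  set ℓ : Ω → E →L[ℝ] ℝ := fun ω => lyapunovCross (M ω) (y ω) with hℓ
  have hℓm : StronglyMeasurable[𝒢] ℓ :=
    stronglyMeasurable_lyapunovCross hMm hym
  have hwsq := hw2.integrable_norm_pow two_ne_zero
  have hℓint : Integrable (fun ω => ℓ ω (w ω)) μ := by
    refine (((hy2.integrable_norm_pow two_ne_zero).add hwsq).const_mul 2).mono'
      (stronglyMeasurable_clm_apply (hℓm.mono h𝒢) hwm).aestronglyMeasurable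
      (ae_of_all _ fun ω => ?_)
    have i1 := abs_le.1 (abs_real_inner_le_norm (y ω) (w ω))
    have i2 := abs_le.1 (abs_inner_apply_le (hM ω) (y ω) (w ω))
    have i3 := abs_le.1 (abs_inner_apply_le (hM ω) (w ω) (y ω))
    rw [real_inner_comm] at i3
    simp only [hℓ, lyapunovCross_apply, Real.norm_eq_abs, Pi.add_apply]
    rw [abs_le]
    have := two_mul_le_add_sq ‖y ω‖ ‖w ω‖
    constructor <;> nlinarith [mul_nonneg (norm_nonneg (y ω)) (norm_nonneg (w ω))]
  have hℓ0 : μ[fun ω => ℓ ω (w ω) | 𝒢] =ᵐ[μ] 0 := by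
    have := condExp_clm_apply hℓm hℓint (hw2.integrable one_le_two)
    filter_upwards [this, hw0] with ω h1 h2
    rw [h1, h2]
    simp
  obtain ⟨-, hL⟩ := integrable_lyapunov (hMm.mono h𝒢) hM (hym.mono h𝒢) hy2
  obtain ⟨-, hL2⟩ := integrable_lyapunov (hMm.mono h𝒢) hM
    ((hym.mono h𝒢).add (hwm.const_smul a)) (hy2.add (hw2.const_smul a))
  have hLm : StronglyMeasurable[𝒢] fun ω => lyapunov (M ω) (y ω) :=
    (hym.norm.pow 2).sub
      ((hym.inner (𝕜 := ℝ) (stronglyMeasurable_clm_apply hMm hym)).const_mul 2)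
  have hmono : μ[fun ω => lyapunov (M ω) (y ω + a • w ω) | 𝒢] ≤ᵐ[μ]
      μ[(fun ω => lyapunov (M ω) (y ω)) + (a • fun ω => ℓ ω (w ω))
        + ((2 * a ^ 2) • fun ω => ‖w ω‖ ^ 2) | 𝒢] :=
    condExp_mono hL2 ((hL.add (hℓint.smul a)).add (hwsq.smul _))
      (ae_of_all _ fun ω => lyapunov_add_le (hM ω) (y ω) (w ω) a)
  have s1 := condExp_add (μ := μ) (hL.add (hℓint.smul a)) (hwsq.smul (2 * a ^ 2)) 𝒢
  have s2 := condExp_add (μ := μ) hL (hℓint.smul a) 𝒢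
  have s3 := condExp_smul (μ := μ) a (fun ω => ℓ ω (w ω)) 𝒢
  have s4 := condExp_smul (μ := μ) (2 * a ^ 2) (fun ω => ‖w ω‖ ^ 2) 𝒢
  rw [condExp_of_stronglyMeasurable h𝒢 hLm hL] at s2
  filter_upwards [hmono, s1, s2, s3, s4, hℓ0, hwβ] with ω h0 h1 h2 h3 h4 h5 h6
  refine h0.trans ?_
  rw [h1, Pi.add_apply, h2, Pi.add_apply, h3, h4, Pi.smul_apply, Pi.smul_apply, h5]
  simp only [Pi.zero_apply, smul_eq_mul]
  have : 0 ≤ 2 * a ^ 2 := by positivity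
  nlinarith [mul_le_mul_of_nonneg_left h6 this]

/-- One step of the algorithm decreases the conditional expectation of the perturbed Lyapunov
function. -/
theorem condExp_lyapunov_le [CompleteSpace E] {Ω : Type*} {𝒢 F m0 : MeasurableSpace Ω}
    {μ : Measure Ω} [IsProbabilityMeasure μ] (h𝒢F : 𝒢 ≤ F)
    (hF : F ≤ m0) {D Γ Γ' M : Ω → E →L[ℝ] E} {D' : E →L[ℝ] E} {Γnext : Ω → E →L[ℝ] E}
    {x w xnext : Ω → E} {a b Δ c β : ℝ} (hb : b ≤ 1 / 4) (hc : 0 ≤ c)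
    (hD : ∀ ω, ‖D ω‖ ≤ b) (hΓ : ∀ ω, ‖Γ ω‖ ≤ b) (hM : ∀ ω, ‖M ω‖ ≤ b)
    (hΓnext : ∀ ω, ‖Γnext ω‖ ≤ b) (hMΓ : ∀ ω, ‖M ω - Γ' ω‖ ≤ Δ)
    (hdec : ∀ ω, D ω = D' + Γ ω - Γ' ω) (hcoer : ∀ z, c * ‖z‖ ^ 2 ≤ inner ℝ z (D' z))
    (hDm : StronglyMeasurable[𝒢] D) (hMm : StronglyMeasurable[𝒢] M)
    (hΓm : StronglyMeasurable[m0] Γnext) (hxm : StronglyMeasurable[𝒢] x) (hx2 : MemLp x 2 μ)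
    (hwm : StronglyMeasurable[F] w) (hw2 : MemLp w 2 μ)
    (hw0 : μ[w | 𝒢] =ᵐ[μ] 0) (hwβ : μ[fun ω => ‖w ω‖ ^ 2 | 𝒢] ≤ᵐ[μ] fun _ => β)
    (hmarkov : μ[Γnext | F] =ᵐ[μ] M) (hstep : ∀ ω, xnext ω = x ω - D ω (x ω) + a • w ω) :
    μ[fun ω => lyapunov (Γnext ω) (xnext ω) | 𝒢] ≤ᵐ[μ]
      fun ω => (1 + (12 * b ^ 2 + 4 * Δ) - c) * lyapunov (Γ ω) (x ω) + 2 * a ^ 2 * β := by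
  have h𝒢 : 𝒢 ≤ m0 := h𝒢F.trans hF
  set y : Ω → E := fun ω => x ω - D ω (x ω) with hy
  have hym : StronglyMeasurable[𝒢] y := hxm.sub (stronglyMeasurable_clm_apply hDm hxm)
  have hDx2 : MemLp (fun ω => D ω (x ω)) 2 μ :=
    hx2.of_le_mul (c := b) ((stronglyMeasurable_clm_apply hDm hxm).mono h𝒢).aestronglyMeasurable
      (ae_of_all _ fun ω => (D ω).le_of_opNorm_le (hD ω) _)
  have hy2 : MemLp y 2 μ := hx2.sub hDx2
  have hxn : xnext = fun ω => y ω + a • w ω := funext hstep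
  have hnm : StronglyMeasurable[F] xnext := by
    rw [hxn]; exact (hym.mono h𝒢F).add (hwm.const_smul a)
  have hn2 : MemLp xnext 2 μ := by
    rw [hxn]; exact hy2.add (hw2.const_smul a)
  have hup := condExp_lyapunov_add_le (a := a) h𝒢 (fun ω => (hM ω).trans hb) hMm hym hy2
    (hwm.mono hF) hw2 hw0 hwβ
  -- Conditioning is done in two stages: given `F` the next iterate is known and only the next chain
  -- state is averaged; given `𝒢` the noise is averaged.
  have htower : μ[fun ω => lyapunov (Γnext ω) (xnext ω) | 𝒢]
      =ᵐ[μ] μ[fun ω => lyapunov (M ω) (y ω + a • w ω) | 𝒢] := by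
    have h := condExp_lyapunov_eq hF hΓnext hΓm hnm hn2 hmarkov
    refine (condExp_condExp_of_le h𝒢F hF).symm.trans ((condExp_congr_ae h).trans ?_)
    rw [hxn]
  filter_upwards [htower, hup] with ω h1 h2
  rw [h1]
  refine h2.trans ?_
  have h3 := lyapunov_step_le hb (hD ω) (hM ω) (hMΓ ω) (hdec ω) (x ω) (hcoer (x ω))
  have h4 := abs_le.1 (abs_lyapunov_sub_le ((hΓ ω).trans hb) (x ω))
  have hΔ : 0 ≤ Δ := (norm_nonneg _).trans (hMΓ ω)
  -- As `b ≤ 1 / 4`, the Lyapunov function and `‖x‖²` agree up to a factor `2`: this doubles the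
  -- error constants to `12` and `4` and turns the drift `2 * c` into `c`.
  have h5 : ‖x ω‖ ^ 2 ≤ 2 * lyapunov (Γ ω) (x ω) := by linarith [h4.1]
  have h6 : lyapunov (Γ ω) (x ω) ≤ 2 * ‖x ω‖ ^ 2 := by nlinarith [h4.2, sq_nonneg ‖x ω‖]
  have h7 : 0 ≤ 6 * b ^ 2 + 2 * Δ := by positivity
  have h8 := mul_le_mul_of_nonneg_left h5 h7
  have h9 := mul_le_mul_of_nonneg_left h6 hc
  change lyapunov (M ω) (y ω) ≤ _ at h3
  linarith

variable {Ω : Type*} [m0 : MeasurableSpace Ω] {μ : Measure Ω} [IsProbabilityMeasure μ]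

omit [IsProbabilityMeasure μ] in
theorem memLp_of_linear_recursion {S : Type*} [Countable S] [MeasurableSpace S]
    [DiscreteMeasurableSpace S] (𝒢 : Filtration ℕ m0) {F : ℕ → MeasurableSpace Ω}
    (h𝒢F : ∀ k, 𝒢 k ≤ F k) (hF𝒢 : ∀ k, F k ≤ 𝒢 (k + 1)) {Y : ℕ → Ω → S}
    (hY : ∀ k, Measurable[𝒢 k] (Y k)) {D : ℕ → S → E →L[ℝ] E} {b a : ℕ → ℝ}
    (hD : ∀ k s, ‖D k s‖ ≤ b k) {x w : ℕ → Ω → E}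
    (hwm : ∀ k, StronglyMeasurable[F k] (w k)) (hw2 : ∀ k, MemLp (w k) 2 μ)
    (hx0 : StronglyMeasurable[𝒢 0] (x 0)) (hx02 : MemLp (x 0) 2 μ)
    (hstep : ∀ k ω, x (k + 1) ω = x k ω - D k (Y k ω) (x k ω) + a k • w k ω) (k : ℕ) :
    StronglyMeasurable[𝒢 k] (x k) ∧ MemLp (x k) 2 μ := by
  induction k with
  | zero => exact ⟨hx0, hx02⟩
  | succ k ih =>
    have hDm : StronglyMeasurable[𝒢 k] fun ω => D k (Y k ω) :=
      (StronglyMeasurable.of_discrete (f := D k)).comp_measurable (hY k)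
    have hDx := stronglyMeasurable_clm_apply hDm ih.1
    have hDx2 : MemLp (fun ω => D k (Y k ω) (x k ω)) 2 μ :=
      ih.2.of_le_mul (c := b k) (hDx.mono (𝒢.le k)).aestronglyMeasurable
        (ae_of_all _ fun ω => (D k (Y k ω)).le_of_opNorm_le (hD k _) _)
    have e : x (k + 1) = fun ω => x k ω - D k (Y k ω) (x k ω) + a k • w k ω := funext (hstep k)
    rw [e]
    exact ⟨((ih.1.sub hDx).mono ((h𝒢F k).trans (hF𝒢 k))).add
      (((hwm k).mono (hF𝒢 k)).const_smul _), (ih.2.sub hDx2).add ((hw2 k).const_smul _)⟩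

/-- Convergence of a linear recursion driven by a Markov chain, small step sizes. -/
theorem tendsto_of_small_steps [CompleteSpace E] {S : Type*} [Countable S] [MeasurableSpace S]
    [DiscreteMeasurableSpace S] {P : S → S → ℝ} (hP : IsTransitionMatrix P)
    (𝒢 : Filtration ℕ m0) {F : ℕ → MeasurableSpace Ω}
    (h𝒢F : ∀ k, 𝒢 k ≤ F k) (hF𝒢 : ∀ k, F k ≤ 𝒢 (k + 1)) {Y : ℕ → Ω → S}
    (hY : ∀ k, Measurable[𝒢 k] (Y k))
    (hmarkov : ∀ k (g : S → E →L[ℝ] E) (C : ℝ), (∀ s, ‖g s‖ ≤ C) →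
      μ[fun ω => g (Y (k + 1) ω) | F k] =ᵐ[μ] fun ω => transitionOp P g (Y k ω))
    {D Γ : ℕ → S → E →L[ℝ] E} {D' : ℕ → E →L[ℝ] E} {a b Δ : ℕ → ℝ} {c β : ℝ}
    (hb : ∀ k, b k ≤ 1 / 4) (hbanti : Antitone b) (ha : ∀ k, 0 ≤ a k) (hc : 0 < c) (hβ : 0 ≤ β)
    (hD : ∀ k s, ‖D k s‖ ≤ b k) (hΓ : ∀ k s, ‖Γ k s‖ ≤ b k)
    (hΔ : ∀ k s, ‖Γ (k + 1) s - Γ k s‖ ≤ Δ k)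
    (hdec : ∀ k s, D k s = D' k + Γ k s - transitionOp P (Γ k) s)
    (hcoer : ∀ k z, c * a k * ‖z‖ ^ 2 ≤ inner ℝ z (D' k z))
    (hbs : Summable fun k => b k ^ 2) (has : Summable fun k => a k ^ 2) (hΔs : Summable Δ)
    (hasum : Tendsto (fun K => ∑ k ∈ Finset.range K, a k) atTop atTop)
    {x w : ℕ → Ω → E} (hxm : ∀ k, StronglyMeasurable[𝒢 k] (x k)) (hx2 : ∀ k, MemLp (x k) 2 μ)
    (hwm : ∀ k, StronglyMeasurable[F k] (w k)) (hw2 : ∀ k, MemLp (w k) 2 μ)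
    (hw0 : ∀ k, μ[w k | 𝒢 k] =ᵐ[μ] 0)
    (hwβ : ∀ k, μ[fun ω => ‖w k ω‖ ^ 2 | 𝒢 k] ≤ᵐ[μ] fun _ => β)
    (hstep : ∀ k ω, x (k + 1) ω = x k ω - D k (Y k ω) (x k ω) + a k • w k ω) :
    Tendsto (fun k => ∫ ω, ‖x k ω‖ ^ 2 ∂μ) atTop (𝓝 0) ∧
      ∀ᵐ ω ∂μ, Tendsto (fun k => x k ω) atTop (𝓝 0) := by
  have hF : ∀ k, F k ≤ m0 := fun k => (hF𝒢 k).trans (𝒢.le _)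
  have hmeas : ∀ k (g : S → E →L[ℝ] E), StronglyMeasurable[𝒢 k] fun ω => g (Y k ω) :=
    fun k g => (StronglyMeasurable.of_discrete (f := g)).comp_measurable (hY k)
  -- A state is needed to read off `0 ≤ b k` and `0 ≤ Δ k` from the norm bounds.
  obtain hS | ⟨⟨s₀⟩⟩ := isEmpty_or_nonempty S
  · have hΩ : IsEmpty Ω := ⟨fun ω => hS.elim (Y 0 ω)⟩
    exact absurd (measure_univ (μ := μ)) (by simp [Set.eq_empty_of_isEmpty])
  have hb0 : ∀ k, 0 ≤ b k := fun k => (norm_nonneg _).trans (hD k s₀)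
  have hΔ0 : ∀ k, 0 ≤ Δ k := fun k => (norm_nonneg _).trans (hΔ k s₀)
  have hMΔ : ∀ k s, ‖transitionOp P (Γ (k + 1)) s - transitionOp P (Γ k) s‖ ≤ Δ k := by
    intro k s
    have e : transitionOp P (Γ (k + 1)) s - transitionOp P (Γ k) s
        = transitionOp P (fun t => Γ (k + 1) t - Γ k t) s := by
      simp only [transitionOp, smul_sub]
      exact ((summable_smul_of_bounded (hP.summable_abs s) (hΓ (k + 1))).tsum_sub
        (summable_smul_of_bounded (hP.summable_abs s) (hΓ k))).symm
    rw [e]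
    exact hP.norm_transitionOp_le (hΔ k) s
  set U : ℕ → Ω → ℝ := fun k ω => lyapunov (Γ k (Y k ω)) (x k ω) with hU
  have hUx : ∀ k ω, 1 / 2 * ‖x k ω‖ ^ 2 ≤ U k ω := fun k ω => by
    have := (abs_le.1 (abs_lyapunov_sub_le ((hΓ k (Y k ω)).trans (hb k)) (x k ω))).1
    simp only [hU]
    linarith
  have hUint : ∀ k, Integrable (U k) μ := fun k =>
    (integrable_lyapunov ((hmeas k (Γ k)).mono (𝒢.le k)) (fun ω => hΓ k _)
      ((hxm k).mono (𝒢.le k)) (hx2 k)).2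
  have hUadp : StronglyAdapted 𝒢 U := fun k =>
    ((hxm k).norm.pow 2).sub (((hxm k).inner (𝕜 := ℝ)
      (stronglyMeasurable_clm_apply (hmeas k (Γ k)) (hxm k))).const_mul 2)
  obtain ⟨h1, h2⟩ := almostSupermartingale_tendsto_zero (μ := μ) 𝒢 (U := U)
    (ε := fun k => 12 * b k ^ 2 + 4 * Δ k) (c := fun k => c * a k)
    (δ := fun k => 2 * a k ^ 2 * β) hUadp hUint
    (fun k => ae_of_all _ fun ω => le_trans (by positivity) (hUx k ω))
    (fun k => add_nonneg (by positivity) (mul_nonneg (by norm_num) (hΔ0 k)))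
    (fun k => mul_nonneg hc.le (ha k)) (fun k => by positivity)
    (fun k => condExp_lyapunov_le (h𝒢F k) (hF k) (D := fun ω => D k (Y k ω))
      (Γ := fun ω => Γ k (Y k ω)) (Γ' := fun ω => transitionOp P (Γ k) (Y k ω))
      (M := fun ω => transitionOp P (Γ (k + 1)) (Y k ω)) (D' := D' k)
      (hb k) (mul_nonneg hc.le (ha k)) (fun ω => hD k _) (fun ω => hΓ k _)
      (fun ω => hP.norm_transitionOp_le
        (fun s => (hΓ (k + 1) s).trans (hbanti k.le_succ)) _)
      (fun ω => (hΓ (k + 1) _).trans (hbanti k.le_succ)) (fun ω => hMΔ k _)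
      (fun ω => hdec k _) (hcoer k) (hmeas k _) (hmeas k _)
      ((hmeas (k + 1) _).mono (𝒢.le _)) (hxm k) (hx2 k) (hwm k) (hw2 k) (hw0 k) (hwβ k)
      (hmarkov k _ _ (hΓ (k + 1))) (hstep k))
    ((hbs.mul_left 12).add (hΔs.mul_left 4)) ((has.mul_left 2).mul_right β)
    (by simp_rw [← Finset.mul_sum]; exact hasum.const_mul_atTop hc)
  constructor
  · refine squeeze_zero (fun k => integral_nonneg fun ω => by positivity) (fun k => ?_)
      (by simpa using h1.const_mul 2)
    rw [← integral_const_mul]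
    exact integral_mono ((hx2 k).integrable_norm_pow two_ne_zero) ((hUint k).const_mul 2)
      fun ω => by have := hUx k ω; simp only; linarith
  · filter_upwards [h2] with ω hω
    have h3 : Tendsto (fun k => ‖x k ω‖ ^ 2) atTop (𝓝 0) :=
      squeeze_zero (g := fun k => 2 * U k ω) (fun k => by positivity)
        (fun k => by have := hUx k ω; linarith) (by simpa using hω.const_mul 2)
    have h4 := (Real.continuous_sqrt.tendsto 0).comp h3
    rw [Real.sqrt_zero] at h4
    refine tendsto_zero_iff_norm_tendsto_zero.2 (h4.congr fun k => ?_)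
    simp [Real.sqrt_sq]

/-- Convergence of a linear recursion driven by a Markov chain. -/
theorem tendsto_of_markov_recursion [CompleteSpace E] {S : Type*} [Countable S]
    [MeasurableSpace S] [DiscreteMeasurableSpace S] {P : S → S → ℝ} (hP : IsTransitionMatrix P)
    (𝒢 : Filtration ℕ m0) {F : ℕ → MeasurableSpace Ω}
    (h𝒢F : ∀ k, 𝒢 k ≤ F k) (hF𝒢 : ∀ k, F k ≤ 𝒢 (k + 1)) {Y : ℕ → Ω → S}
    (hY : ∀ k, Measurable[𝒢 k] (Y k))
    (hmarkov : ∀ k (g : S → E →L[ℝ] E) (C : ℝ), (∀ s, ‖g s‖ ≤ C) →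
      μ[fun ω => g (Y (k + 1) ω) | F k] =ᵐ[μ] fun ω => transitionOp P g (Y k ω))
    {D Γ : ℕ → S → E →L[ℝ] E} {D' : ℕ → E →L[ℝ] E} {a b Δ : ℕ → ℝ} {c β : ℝ}
    (hb : Tendsto b atTop (𝓝 0)) (hbanti : Antitone b) (ha : ∀ k, 0 ≤ a k) (hc : 0 < c)
    (hβ : 0 ≤ β) (hD : ∀ k s, ‖D k s‖ ≤ b k) (hΓ : ∀ k s, ‖Γ k s‖ ≤ b k)
    (hΔ : ∀ k s, ‖Γ (k + 1) s - Γ k s‖ ≤ Δ k)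
    (hdec : ∀ k s, D k s = D' k + Γ k s - transitionOp P (Γ k) s)
    (hcoer : ∀ k z, c * a k * ‖z‖ ^ 2 ≤ inner ℝ z (D' k z))
    (hbs : Summable fun k => b k ^ 2) (has : Summable fun k => a k ^ 2) (hΔs : Summable Δ)
    (hasum : Tendsto (fun K => ∑ k ∈ Finset.range K, a k) atTop atTop)
    {x w : ℕ → Ω → E} (hx0 : StronglyMeasurable[𝒢 0] (x 0)) (hx02 : MemLp (x 0) 2 μ)
    (hwm : ∀ k, StronglyMeasurable[F k] (w k)) (hw2 : ∀ k, MemLp (w k) 2 μ)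
    (hw0 : ∀ k, μ[w k | 𝒢 k] =ᵐ[μ] 0)
    (hwβ : ∀ k, μ[fun ω => ‖w k ω‖ ^ 2 | 𝒢 k] ≤ᵐ[μ] fun _ => β)
    (hstep : ∀ k ω, x (k + 1) ω = x k ω - D k (Y k ω) (x k ω) + a k • w k ω) :
    (∀ k, MemLp (x k) 2 μ) ∧ Tendsto (fun k => ∫ ω, ‖x k ω‖ ^ 2 ∂μ) atTop (𝓝 0) ∧
      ∀ᵐ ω ∂μ, Tendsto (fun k => x k ω) atTop (𝓝 0) := by
  have hx := memLp_of_linear_recursion 𝒢 h𝒢F hF𝒢 hY hD hwm hw2 hx0 hx02 hstep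
  refine ⟨fun k => (hx k).2, ?_⟩
  -- The recursion is restarted at a time `K` after which the steps are small; square integrability
  -- up to `K` comes from `memLp_of_linear_recursion`.
  obtain ⟨K, hK⟩ := eventually_atTop.1 (hb.eventually_le_const (show (0 : ℝ) < 1 / 4 by norm_num))
  have hshift : ∀ {f : ℕ → ℝ}, Summable f → Summable fun k => f (K + k) := fun {f} hf => by
    simpa only [add_comm K] using (summable_nat_add_iff K).2 hf
  have hasum' : Tendsto (fun N => ∑ k ∈ Finset.range N, a (K + k)) atTop atTop := by
    have h1 := tendsto_atTop_add_const_right atTop (-∑ k ∈ Finset.range K, a k)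
      ((tendsto_add_atTop_iff_nat K).2 hasum)
    refine h1.congr fun N => ?_
    rw [add_comm N K, Finset.sum_range_add]
    ring
  obtain ⟨h1, h2⟩ := tendsto_of_small_steps (μ := μ) hP
    (⟨fun k => 𝒢 (K + k), fun i j hij => 𝒢.mono (Nat.add_le_add_left hij K),
      fun k => 𝒢.le _⟩ : Filtration ℕ m0)
    (F := fun k => F (K + k)) (fun k => h𝒢F (K + k)) (fun k => hF𝒢 (K + k))
    (Y := fun k => Y (K + k)) (fun k => hY (K + k)) (fun k => hmarkov (K + k))
    (D := fun k => D (K + k)) (Γ := fun k => Γ (K + k)) (D' := fun k => D' (K + k))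
    (a := fun k => a (K + k)) (b := fun k => b (K + k)) (Δ := fun k => Δ (K + k))
    (fun k => hK _ (Nat.le_add_right K k)) (fun i j hij => hbanti (Nat.add_le_add_left hij K))
    (fun k => ha _) hc hβ (fun k => hD _) (fun k => hΓ _) (fun k => hΔ (K + k))
    (fun k => hdec _) (fun k => hcoer _) (hshift hbs) (hshift has) (hshift hΔs) hasum'
    (x := fun k => x (K + k)) (w := fun k => w (K + k)) (fun k => (hx (K + k)).1)
    (fun k => (hx (K + k)).2) (fun k => hwm _) (fun k => hw2 _) (fun k => hw0 (K + k))
    (fun k => hwβ (K + k)) (fun k => hstep (K + k))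
  constructor
  · simp only [add_comm K] at h1
    exact (tendsto_add_atTop_iff_nat K).1 h1
  · filter_upwards [h2] with ω hω
    simp only [add_comm K] at hω
    exact (tendsto_add_atTop_iff_nat K).1 hω

end StochasticApproximation

/-! ## Operators of the network -/

section Operators

/-- The space of the stacked estimates of all nodes. -/
abbrev NetSpace (N n : ℕ) : Type := PiLp 2 fun _ : Fin N => EuclideanSpace ℝ (Fin n)

/-- A matrix as a continuous linear map between Euclidean spaces. -/
noncomputable def matCLM {m n : Type*} [Fintype m] [Fintype n] [DecidableEq n]
    (B : Matrix m n ℝ) : EuclideanSpace ℝ n →L[ℝ] EuclideanSpace ℝ m :=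
  LinearMap.toContinuousLinearMap (Matrix.toEuclideanLin B)

theorem matCLM_apply {m n : Type*} [Fintype m] [Fintype n] [DecidableEq n] (B : Matrix m n ℝ)
    (x : EuclideanSpace ℝ n) : matCLM B x = Matrix.toEuclideanLin B x := rfl

theorem matCLM_apply_apply {m n : Type*} [Fintype m] [Fintype n] [DecidableEq n]
    (B : Matrix m n ℝ) (x : EuclideanSpace ℝ n) (i : m) : matCLM B x i = ∑ j, B i j * x j := rfl

theorem abs_entry_le_matrixTwoNorm {m n : Type*} [Fintype m] [Fintype n] [DecidableEq n]
    (B : Matrix m n ℝ) (i : m) (j : n) : |B i j| ≤ matrixTwoNorm B := by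
  have h1 : matCLM B (EuclideanSpace.single j 1) i = B i j := by
    rw [matCLM_apply_apply]
    simp
  calc |B i j| = ‖matCLM B (EuclideanSpace.single j 1) i‖ := by rw [h1, Real.norm_eq_abs]
    _ ≤ ‖matCLM B (EuclideanSpace.single j 1)‖ := PiLp.norm_apply_le _ i
    _ ≤ ‖matCLM B‖ * ‖EuclideanSpace.single j (1 : ℝ)‖ := (matCLM B).le_opNorm _
    _ = matrixTwoNorm B := by simp [matrixTwoNorm, matCLM]

/-- `K` depends on the sizes only, so entrywise bounds valid on all of the state space give uniform
operator bounds. -/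
theorem norm_matCLM_le {m n : Type*} [Fintype m] [Fintype n] [DecidableEq m] [DecidableEq n] :
    ∃ K : ℝ, 0 ≤ K ∧ ∀ (B : Matrix m n ℝ) (C : ℝ), (∀ i j, |B i j| ≤ C) → ‖matCLM B‖ ≤ K * C := by
  refine ⟨∑ i : m, ∑ j : n, ‖matCLM (Matrix.single i j (1 : ℝ))‖,
    Finset.sum_nonneg fun i _ => Finset.sum_nonneg fun j _ => norm_nonneg _, fun B C hB => ?_⟩
  have h : matCLM B = ∑ i, ∑ j, B i j • matCLM (Matrix.single i j (1 : ℝ)) := by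
    conv_lhs => rw [Matrix.matrix_eq_sum_single B]
    simp only [matCLM, map_sum]
    refine Finset.sum_congr rfl fun i _ => Finset.sum_congr rfl fun j _ => ?_
    rw [← map_smul, ← map_smul, Matrix.smul_single, smul_eq_mul, mul_one]
  rw [h, Finset.sum_mul]
  refine (norm_sum_le _ _).trans (Finset.sum_le_sum fun i _ => ?_)
  rw [Finset.sum_mul]
  refine (norm_sum_le _ _).trans (Finset.sum_le_sum fun j _ => ?_)
  rw [norm_smul, mul_comm, Real.norm_eq_abs]
  exact mul_le_mul_of_nonneg_left (hB i j) (norm_nonneg _)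

theorem inner_matCLM_transpose {m n : Type*} [Fintype m] [Fintype n] [DecidableEq m]
    [DecidableEq n] (B : Matrix m n ℝ) (x : EuclideanSpace ℝ n) (y : EuclideanSpace ℝ m) :
    inner ℝ x (matCLM Bᵀ y) = inner ℝ (matCLM B x) y := by
  rw [matCLM_apply, matCLM_apply, ← Matrix.conjTranspose_eq_transpose_of_trivial,
    Matrix.toEuclideanLin_conjTranspose_eq_adjoint, LinearMap.adjoint_inner_right]

theorem norm_sq_matCLM {m n : Type*} [Fintype m] [Fintype n] [DecidableEq m] [DecidableEq n]
    (B : Matrix m n ℝ) (x : EuclideanSpace ℝ n) :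
    ‖matCLM B x‖ ^ 2 = ∑ p, ∑ q, (Bᵀ * B) p q * (x p * x q) := by
  rw [← real_inner_self_eq_norm_sq, PiLp.inner_apply]
  simp only [matCLM_apply_apply, Matrix.mul_apply, Matrix.transpose_apply, RCLike.inner_apply,
    conj_trivial, Finset.sum_mul, Finset.mul_sum]
  rw [Finset.sum_comm]
  refine Finset.sum_congr rfl fun p _ => ?_
  rw [Finset.sum_comm]
  refine Finset.sum_congr rfl fun q _ => Finset.sum_congr rfl fun i _ => ?_
  ring

variable {N n : ℕ} {d : Fin N → ℕ}

/-- The embedding of the space of one node. -/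
noncomputable def nodeEmbed (i : Fin N) : EuclideanSpace ℝ (Fin n) →L[ℝ] NetSpace N n :=
  ((PiLp.continuousLinearEquiv 2 ℝ fun _ : Fin N => EuclideanSpace ℝ (Fin n)).symm :
      (Fin N → EuclideanSpace ℝ (Fin n)) →L[ℝ] NetSpace N n) ∘L
    ContinuousLinearMap.single ℝ (fun _ : Fin N => EuclideanSpace ℝ (Fin n)) i

theorem nodeEmbed_apply (i : Fin N) (u : EuclideanSpace ℝ (Fin n)) (j : Fin N) :
    nodeEmbed i u j = if j = i then u else 0 := by
  change Pi.single (M := fun _ => EuclideanSpace ℝ (Fin n)) i u j = _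
  rw [Pi.single_apply]

/-- The projection to the space of one node. -/
noncomputable abbrev nodeProj (i : Fin N) : NetSpace N n →L[ℝ] EuclideanSpace ℝ (Fin n) :=
  PiLp.proj 2 (fun _ : Fin N => EuclideanSpace ℝ (Fin n)) i

/-- The effect of the noise of one node. -/
noncomputable def noiseOp (H : ObsFamily N n d) (i : Fin N) :
    EuclideanSpace ℝ (Fin (d i)) →L[ℝ] NetSpace N n :=
  nodeEmbed i ∘L matCLM (H i)ᵀ

/-- The block diagonal operator with the blocks `(H i)ᵀ * H i`. -/
noncomputable def obsOp (H : ObsFamily N n d) : NetSpace N n →L[ℝ] NetSpace N n :=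
  ∑ i, noiseOp H i ∘L (matCLM (H i) ∘L nodeProj i)

/-- The Laplacian of a weighted digraph, acting on the stacked estimates. -/
noncomputable def lapOp (B : Matrix (Fin N) (Fin N) ℝ) : NetSpace N n →L[ℝ] NetSpace N n :=
  ∑ i, ∑ j, B i j • (nodeEmbed i ∘L (nodeProj i - nodeProj j))

theorem sum_nodeEmbed_apply (u : Fin N → EuclideanSpace ℝ (Fin n)) (j : Fin N) :
    (∑ i, nodeEmbed i (u i) : NetSpace N n) j = u j := by
  rw [← PiLp.proj_apply (𝕜 := ℝ) 2 (fun _ : Fin N => EuclideanSpace ℝ (Fin n)) j, map_sum]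
  simp [nodeEmbed_apply]

theorem obsOp_apply (H : ObsFamily N n d) (x : NetSpace N n) (i : Fin N) :
    obsOp H x i = matCLM (H i)ᵀ (matCLM (H i) (x i)) := by
  rw [← sum_nodeEmbed_apply (fun i => matCLM (H i)ᵀ (matCLM (H i) (x i))) i]
  simp [obsOp, noiseOp]

theorem lapOp_apply (B : Matrix (Fin N) (Fin N) ℝ) (x : NetSpace N n) (i : Fin N) :
    lapOp B x i = ∑ j, B i j • (x i - x j) := by
  rw [← sum_nodeEmbed_apply (fun i => ∑ j, B i j • (x i - x j)) i]
  simp [lapOp]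

theorem sum_noiseOp_apply (H : ObsFamily N n d) (v : NoiseFamily N d) (i : Fin N) :
    (∑ j, noiseOp H j (v j) : NetSpace N n) i = matCLM (H i)ᵀ (v i) := by
  rw [← sum_nodeEmbed_apply (fun i => matCLM (H i)ᵀ (v i)) i]
  simp [noiseOp]

theorem inner_obsOp (H : ObsFamily N n d) (x : NetSpace N n) :
    inner ℝ x (obsOp H x) = ∑ i, ‖matCLM (H i) (x i)‖ ^ 2 := by
  rw [PiLp.inner_apply]
  refine Finset.sum_congr rfl fun i _ => ?_
  rw [obsOp_apply, inner_matCLM_transpose, real_inner_self_eq_norm_sq]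

theorem inner_lapOp (B : Matrix (Fin N) (Fin N) ℝ) (x : NetSpace N n) :
    inner ℝ x (lapOp B x) = ∑ i, ∑ j, B i j * inner ℝ (x i) (x i - x j) := by
  rw [PiLp.inner_apply]
  refine Finset.sum_congr rfl fun i _ => ?_
  rw [lapOp_apply, inner_sum]
  simp only [inner_smul_right]

theorem abs_entry_le_blockObs (H : ObsFamily N n d) (i : Fin N) (p : Fin (d i)) (q : Fin n) :
    |H i p q| ≤ matrixTwoNorm (blockObs H) := by
  have h := abs_entry_le_matrixTwoNorm (blockObs H) ⟨i, p⟩ ⟨i, q⟩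
  rwa [blockObs, Matrix.blockDiagonal'_apply_eq] at h

theorem exists_norm_noiseOp_le {C : ℝ} : ∃ K : ℝ, 0 ≤ K ∧ ∀ H : ObsFamily N n d,
    (∀ i p q, |H i p q| ≤ C) → ∀ i, ‖noiseOp H i‖ ≤ K := by
  choose K hK0 hK using fun i : Fin N => norm_matCLM_le (m := Fin n) (n := Fin (d i))
  refine ⟨∑ i, ‖nodeEmbed (N := N) (n := n) i‖ * (K i * |C|), Finset.sum_nonneg fun i _ => by
    have := hK0 i
    positivity, fun H hH i => ?_⟩
  have h1 : ‖noiseOp H i‖ ≤ ‖nodeEmbed (N := N) (n := n) i‖ * (K i * |C|) :=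
    (ContinuousLinearMap.opNorm_comp_le _ _).trans (mul_le_mul_of_nonneg_left
      (hK i _ _ fun p q => (hH i q p).trans (le_abs_self C)) (norm_nonneg _))
  exact h1.trans (Finset.single_le_sum (f := fun i => ‖nodeEmbed (N := N) (n := n) i‖ * (K i * |C|))
    (fun j _ => by
      have := hK0 j
      positivity) (Finset.mem_univ i))

theorem exists_norm_obsOp_le {C : ℝ} : ∃ K : ℝ, ∀ H : ObsFamily N n d,
    (∀ i p q, |H i p q| ≤ C) → ‖obsOp H‖ ≤ K := by
  obtain ⟨K, hK0, hK⟩ := exists_norm_noiseOp_le (N := N) (n := n) (d := d) (C := C)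
  choose K' hK0' hK' using fun i : Fin N => norm_matCLM_le (m := Fin (d i)) (n := Fin n)
  refine ⟨∑ i, K * (K' i * C * ‖nodeProj (N := N) (n := n) i‖), fun H hH => ?_⟩
  refine (norm_sum_le _ _).trans (Finset.sum_le_sum fun i _ => ?_)
  refine (ContinuousLinearMap.opNorm_comp_le _ _).trans
    (mul_le_mul (hK H hH i) ?_ (norm_nonneg _) hK0)
  exact (ContinuousLinearMap.opNorm_comp_le _ _).trans
    (mul_le_mul_of_nonneg_right (hK' i _ _ (hH i)) (norm_nonneg _))

theorem exists_norm_lapOp_le {C : ℝ} : ∃ K : ℝ, ∀ B : Matrix (Fin N) (Fin N) ℝ,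
    (∀ i j, |B i j| ≤ C) → ‖lapOp (n := n) B‖ ≤ K := by
  refine ⟨∑ i, ∑ j, C * ‖nodeEmbed (N := N) (n := n) i ∘L (nodeProj i - nodeProj j)‖,
    fun B hB => ?_⟩
  refine (norm_sum_le _ _).trans (Finset.sum_le_sum fun i _ => ?_)
  refine (norm_sum_le _ _).trans (Finset.sum_le_sum fun j _ => ?_)
  rw [norm_smul, Real.norm_eq_abs]
  exact mul_le_mul_of_nonneg_right (hB i j) (norm_nonneg _)

/-! ### Coercivity of the mean dynamics -/

/-- Polarisation gives `2⟪x i, x i - x j⟫ = ‖x i - x j‖² + ‖x i‖² - ‖x j‖²`, and balance cancels the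
last two terms after weighted summation. -/
theorem inner_lapOp_of_isBalanced {B : Matrix (Fin N) (Fin N) ℝ} (hB : IsBalanced B)
    (x : NetSpace N n) :
    inner ℝ x (lapOp B x) = 1 / 2 * ∑ i, ∑ j, B i j * ‖x i - x j‖ ^ 2 := by
  have h1 : ∑ i, ∑ j, B i j * ‖x i‖ ^ 2 = ∑ i, ∑ j, B i j * ‖x j‖ ^ 2 := by
    rw [Finset.sum_comm (f := fun i j => B i j * ‖x j‖ ^ 2)]
    simp only [← Finset.sum_mul]
    exact Finset.sum_congr rfl fun i _ => by rw [hB i]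
  have h2 : ∀ i j, B i j * inner ℝ (x i) (x i - x j)
      = 1 / 2 * (B i j * ‖x i - x j‖ ^ 2) + 1 / 2 * (B i j * ‖x i‖ ^ 2)
        - 1 / 2 * (B i j * ‖x j‖ ^ 2) := by
    intro i j
    rw [norm_sub_sq_real, inner_sub_right, real_inner_self_eq_norm_sq]
    ring
  rw [inner_lapOp]
  simp only [h2, Finset.sum_add_distrib, Finset.sum_sub_distrib, ← Finset.mul_sum]
  rw [h1]
  ring

theorem inner_lapOp_nonneg {B : Matrix (Fin N) (Fin N) ℝ} (hB : IsBalanced B)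
    (hB0 : ∀ i j, 0 ≤ B i j) (x : NetSpace N n) : 0 ≤ inner ℝ x (lapOp B x) := by
  rw [inner_lapOp_of_isBalanced hB]
  exact mul_nonneg (by norm_num) (Finset.sum_nonneg fun i _ => Finset.sum_nonneg fun j _ =>
    mul_nonneg (hB0 i j) (sq_nonneg _))

/-- Every term of the Dirichlet form vanishes, so values agree along edges, and following parents
reaches the root. -/
theorem exists_eq_const_of_inner_lapOp_eq_zero {B : Matrix (Fin N) (Fin N) ℝ} (hB : IsBalanced B)
    (hB0 : ∀ i j, 0 ≤ B i j) (htree : HasSpanningTree B) {x : NetSpace N n}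
    (hx : inner ℝ x (lapOp B x) = 0) : ∃ r, ∀ i, x i = x r := by
  obtain ⟨r, parent, hpar, hroot⟩ := htree
  have hedge : ∀ i, i ≠ r → x i = x (parent i) := by
    intro i hi
    rw [inner_lapOp_of_isBalanced hB] at hx
    have h0 : ∑ i, ∑ j, B i j * ‖x i - x j‖ ^ 2 = 0 := by linarith
    have h1 := (Finset.sum_eq_zero_iff_of_nonneg fun i _ => Finset.sum_nonneg fun j _ =>
      mul_nonneg (hB0 i j) (sq_nonneg ‖x i - x j‖)).1 h0 i (Finset.mem_univ i)
    have h2 := (Finset.sum_eq_zero_iff_of_nonneg fun j _ =>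
      mul_nonneg (hB0 i j) (sq_nonneg ‖x i - x j‖)).1 h1 (parent i) (Finset.mem_univ _)
    have h3 := (mul_eq_zero.1 h2).resolve_left (hpar i hi)
    exact sub_eq_zero.1 (norm_eq_zero.1 (pow_eq_zero_iff two_ne_zero |>.1 h3))
  refine ⟨r, fun i => ?_⟩
  obtain ⟨m, hm⟩ := hroot i
  induction m generalizing i with
  | zero => rw [show i = r from hm]
  | succ m ih =>
    by_cases hi : i = r
    · rw [hi]
    · rw [hedge i hi, ih (parent i) hm]

theorem dotProduct_mulVec_pos_of_lambdaMin_pos {B : Matrix (Fin n) (Fin n) ℝ}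
    (hB : B.IsHermitian) (hl : 0 < lambdaMin B) {u : Fin n → ℝ} (hu : u ≠ 0) :
    0 < ∑ p, ∑ q, B p q * (u p * u q) := by
  have hpos : B.PosDef := by
    rw [hB.posDef_iff_eigenvalues_pos]
    intro i
    refine hl.trans_le (csInf_le ?_ (hB.eigenvalues_mem_spectrum_real i))
    rw [hB.spectrum_real_eq_range_eigenvalues]
    exact (Set.finite_range _).bddBelow
  have h := (Matrix.posDef_iff_dotProduct_mulVec.1 hpos).2 hu
  simp only [dotProduct, Matrix.mulVec, Finset.mul_sum, star_trivial] at h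
  refine h.trans_eq (Finset.sum_congr rfl fun p _ => Finset.sum_congr rfl fun q _ => ?_)
  ring

/-- The constant is the minimum of the form on the compact unit sphere; an empty sphere means that
`E` is trivial. -/
theorem exists_coercive_of_pos {E : Type*} [NormedAddCommGroup E] [InnerProductSpace ℝ E]
    [FiniteDimensional ℝ E] {M : E →L[ℝ] E} (hM : ∀ x, x ≠ 0 → 0 < inner ℝ x (M x)) :
    ∃ c > 0, ∀ x, c * ‖x‖ ^ 2 ≤ inner ℝ x (M x) := by
  have hcont : Continuous fun x : E => inner ℝ x (M x) := by fun_prop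
  have hne : ∀ x ∈ Metric.sphere (0 : E) 1, x ≠ 0 := fun x hx =>
    Metric.ne_of_mem_sphere hx one_ne_zero
  obtain h | h := (Metric.sphere (0 : E) 1).eq_empty_or_nonempty
  · refine ⟨1, one_pos, fun x => ?_⟩
    have hx : x = 0 := by
      by_contra hx
      have : (‖x‖⁻¹ • x) ∈ Metric.sphere (0 : E) 1 := by
        rw [mem_sphere_zero_iff_norm, norm_smul, norm_inv, norm_norm,
          inv_mul_cancel₀ (norm_ne_zero_iff.2 hx)]
      rw [h] at this
      exact this
    simp [hx]
  · obtain ⟨z, hz, hmin⟩ := (isCompact_sphere (0 : E) 1).exists_isMinOn h hcont.continuousOn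
    refine ⟨_, hM z (hne z hz), fun x => ?_⟩
    rcases eq_or_ne x 0 with rfl | hx
    · simp
    have hx' : 0 < ‖x‖ := norm_pos_iff.2 hx
    have hmem : (‖x‖⁻¹ • x) ∈ Metric.sphere (0 : E) 1 := by
      rw [mem_sphere_zero_iff_norm, norm_smul, norm_inv, norm_norm, inv_mul_cancel₀ hx'.ne']
    have h1 := isMinOn_iff.1 hmin _ hmem
    rw [map_smul, inner_smul_left, inner_smul_right, conj_trivial] at h1
    calc _ ≤ ‖x‖⁻¹ * (‖x‖⁻¹ * inner ℝ x (M x)) * ‖x‖ ^ 2 := by gcongr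
      _ = _ := by field_simp

theorem HasSum.inner_apply {ι E : Type*} [NormedAddCommGroup E] [InnerProductSpace ℝ E]
    {M : ι → E →L[ℝ] E} {L : E →L[ℝ] E} {p : ι → ℝ} (h : HasSum (fun s => p s • M s) L) (x : E) :
    HasSum (fun s => p s * inner ℝ x (M s x)) (inner ℝ x (L x)) := by
  have := h.mapL (innerSL ℝ x ∘L ContinuousLinearMap.apply ℝ E x)
  simpa [inner_smul_right] using this

variable {S : Set (NetState N n d)} {π : S → ℝ} {C : ℝ}

/-- Bounded states make the series genuinely converge, so the `tsum` defining the mean is not the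
default value `0`. -/
theorem hasSum_adjacency_entry (hπ : Summable fun s => |π s|)
    (hA : ∀ (s : S) i j, |s.1.2 i j| ≤ C) (i j : Fin N) :
    HasSum (fun s => π s * s.1.2 i j) (meanAdjacency π i j) := by
  have hentry : ∀ i j, Summable fun s => π s * s.1.2 i j := fun i j =>
    summable_smul_of_bounded (φ := fun s : S => s.1.2 i j) hπ fun s => hA s i j
  have hs : Summable fun s : S => π s • s.1.2 :=
    Pi.summable.2 fun i => Pi.summable.2 fun j => hentry i j
  exact Pi.hasSum.1 (Pi.hasSum.1 hs.hasSum i) j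

theorem hasSum_gramian_entry (hπ : Summable fun s => |π s|) (hC : 0 ≤ C)
    (hH : ∀ (s : S) i p q, |s.1.1 i p q| ≤ C) (p q : Fin n) :
    HasSum (fun s => π s * ∑ i, ((s.1.1 i)ᵀ * s.1.1 i) p q) (meanGramian π p q) := by
  have hbound : ∀ i p q (s : S), |((s.1.1 i)ᵀ * s.1.1 i) p q| ≤ d i * (C * C) := by
    intro i p q s
    rw [Matrix.mul_apply]
    refine (Finset.abs_sum_le_sum_abs _ _).trans ?_
    calc ∑ r, |(s.1.1 i)ᵀ p r * s.1.1 i r q| ≤ ∑ _r : Fin (d i), C * C := by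
          refine Finset.sum_le_sum fun r _ => ?_
          rw [abs_mul]
          exact mul_le_mul (hH s i r p) (hH s i r q) (abs_nonneg _) hC
      _ = _ := by simp
  have hentry : ∀ i p q, Summable fun s => π s * ((s.1.1 i)ᵀ * s.1.1 i) p q := fun i p q =>
    summable_smul_of_bounded (φ := fun s : S => ((s.1.1 i)ᵀ * s.1.1 i) p q) hπ (hbound i p q)
  have hs : ∀ i, Summable fun s : S => π s • ((s.1.1 i)ᵀ * s.1.1 i) := fun i =>
    Pi.summable.2 fun p => Pi.summable.2 fun q => hentry i p q
  have h1 : ∀ i, HasSum (fun s => π s * ((s.1.1 i)ᵀ * s.1.1 i) p q)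
      ((∑' s : S, π s • ((s.1.1 i)ᵀ * s.1.1 i)) p q) := fun i =>
    Pi.hasSum.1 (Pi.hasSum.1 (hs i).hasSum p) q
  have h2 := hasSum_sum fun i (_ : i ∈ Finset.univ) => h1 i
  simp only [← Finset.mul_sum] at h2
  rwa [meanGramian, Matrix.sum_apply]

/-- Writing `a G + b L = a (G + κ L) + (b - κ a) L`, it suffices that `G + κ L` is positive
definite: either the form of `L` is positive at `x`, or `x` is a consensus vector and joint
observability makes the form of `G` positive. -/
theorem exists_mean_coercive (hπ : Summable π) (hπ0 : ∀ s, 0 ≤ π s) (hC : 0 ≤ C)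
    (hA : ∀ (s : S) i j, |s.1.2 i j| ≤ C) (hH : ∀ (s : S) i p q, |s.1.1 i p q| ≤ C)
    (hnonneg : ∀ i j, 0 ≤ meanAdjacency π i j) (hbal : IsBalanced (meanAdjacency π))
    (htree : HasSpanningTree (meanAdjacency π)) (hobs : 0 < lambdaMin (meanGramian π))
    {G L : NetSpace N n →L[ℝ] NetSpace N n} (hG : HasSum (fun s => π s • obsOp s.1.1) G)
    (hL : HasSum (fun s => π s • lapOp s.1.2) L) {κ : ℝ} (hκ : 0 < κ) :
    ∃ c > 0, ∀ (a b : ℝ), 0 ≤ a → κ * a ≤ b → ∀ x : NetSpace N n, c * a * ‖x‖ ^ 2 ≤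
      inner ℝ x ((a • G + b • L) x) := by
  have hπabs := hπ.abs
  have hLx : ∀ x : NetSpace N n, inner ℝ x (L x) = inner ℝ x (lapOp (meanAdjacency π) x) := by
    intro x
    refine (hL.inner_apply x).unique ?_
    rw [inner_lapOp]
    have h := hasSum_sum fun i (_ : i ∈ Finset.univ) =>
      hasSum_sum fun j (_ : j ∈ Finset.univ) =>
        (hasSum_adjacency_entry hπabs hA i j).mul_right (inner ℝ (x i) (x i - x j))
    refine h.congr_fun ?_
    intro s
    rw [inner_lapOp, Finset.mul_sum]
    refine Finset.sum_congr rfl fun i _ => ?_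
    rw [Finset.mul_sum]
    exact Finset.sum_congr rfl fun j _ => (mul_assoc _ _ _).symm
  have hGx : ∀ x : NetSpace N n, 0 ≤ inner ℝ x (G x) := fun x =>
    (hG.inner_apply x).nonneg fun s => mul_nonneg (hπ0 s) (by
      rw [inner_obsOp]; exact Finset.sum_nonneg fun i _ => sq_nonneg _)
  have hL0 : ∀ x : NetSpace N n, 0 ≤ inner ℝ x (L x) := fun x => by
    rw [hLx]; exact inner_lapOp_nonneg hbal hnonneg x
  have hGconst : ∀ (x : NetSpace N n) (u : EuclideanSpace ℝ (Fin n)), (∀ i, x i = u) →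
      inner ℝ x (G x) = ∑ p, ∑ q, meanGramian π p q * (u p * u q) := by
    intro x u hxu
    refine (hG.inner_apply x).unique ?_
    have h := hasSum_sum fun p (_ : p ∈ Finset.univ) =>
      hasSum_sum fun q (_ : q ∈ Finset.univ) =>
        (hasSum_gramian_entry hπabs hC hH p q).mul_right (u p * u q)
    refine h.congr_fun ?_
    intro s
    rw [inner_obsOp]
    simp only [hxu, norm_sq_matCLM]
    rw [Finset.sum_comm, Finset.mul_sum]
    refine Finset.sum_congr rfl fun p _ => ?_
    rw [Finset.sum_comm, Finset.mul_sum]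
    refine Finset.sum_congr rfl fun q _ => ?_
    rw [← Finset.sum_mul, mul_assoc]
  have hherm : (meanGramian π).IsHermitian := by
    ext p q
    rw [Matrix.conjTranspose_apply, star_trivial]
    refine (hasSum_gramian_entry hπabs hC hH q p).unique
      ((hasSum_gramian_entry hπabs hC hH p q).congr_fun ?_)
    intro s
    congr 1
    refine Finset.sum_congr rfl fun i _ => ?_
    simp only [Matrix.mul_apply, Matrix.transpose_apply]
    exact Finset.sum_congr rfl fun r _ => mul_comm _ _
  obtain ⟨c, hc, hcx⟩ := exists_coercive_of_pos (M := G + κ • L) (by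
    intro x hx
    have e : inner ℝ x ((G + κ • L) x) = inner ℝ x (G x) + κ * inner ℝ x (L x) := by
      simp [inner_add_right, inner_smul_right]
    rw [e]
    rcases (hL0 x).eq_or_lt with h0 | h0
    · obtain ⟨r, hr⟩ := exists_eq_const_of_inner_lapOp_eq_zero hbal hnonneg htree
        ((hLx x).symm.trans h0.symm)
      rw [← h0, hGconst x (x r) hr, mul_zero, add_zero]
      refine dotProduct_mulVec_pos_of_lambdaMin_pos hherm hobs fun hu => hx ?_
      ext i p
      rw [hr i]
      exact congrFun hu p
    · exact add_pos_of_nonneg_of_pos (hGx x) (mul_pos hκ h0))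
  refine ⟨c, hc, fun a b ha hab x => ?_⟩
  have e : inner ℝ x ((a • G + b • L) x)
      = a * inner ℝ x ((G + κ • L) x) + (b - κ * a) * inner ℝ x (L x) := by
    simp [inner_add_right, inner_smul_right]
    ring
  rw [e]
  have h1 := mul_le_mul_of_nonneg_left (hcx x) ha
  have h2 := mul_nonneg (sub_nonneg.2 hab) (hL0 x)
  linarith

end Operators

/-! ## Convergence of the estimates -/

section Network

/-- Used to sum the changes of the correctors `Γ k` in time, which are linear in the increments of
the gains. -/
theorem summable_sub_succ_of_antitone {a : ℕ → ℝ} (ha : Antitone a) (ha0 : ∀ k, 0 ≤ a k) :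
    Summable fun k => a k - a (k + 1) :=
  summable_of_sum_range_le (c := a 0) (fun k => sub_nonneg.2 (ha k.le_succ)) fun K => by
    rw [Finset.sum_range_sub']
    linarith [ha0 K]

theorem transitionOp_add_smul {S V : Type*} [NormedAddCommGroup V] [NormedSpace ℝ V]
    [CompleteSpace V] {P : S → S → ℝ} (hP : IsTransitionMatrix P) {f g : S → V} {C K : ℝ}
    (hf : ∀ s, ‖f s‖ ≤ C) (hg : ∀ s, ‖g s‖ ≤ K) (a b : ℝ) (s : S) :
    transitionOp P (fun t => a • f t + b • g t) s
      = a • transitionOp P f s + b • transitionOp P g s := by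
  have h1 := summable_smul_of_bounded (hP.summable_abs s) hf
  have h2 := summable_smul_of_bounded (hP.summable_abs s) hg
  simp only [transitionOp, smul_add, smul_comm (P s _)]
  rw [(h1.const_smul a).tsum_add (h2.const_smul b), h1.tsum_const_smul, h2.tsum_const_smul]

theorem measurableSingletonClass_netState (N n : ℕ) (d : Fin N → ℕ) :
    MeasurableSingletonClass (NetState N n d) := by
  have h : ∀ {m p : ℕ}, MeasurableSingletonClass (Matrix (Fin m) (Fin p) ℝ) := fun {m p} =>
    inferInstanceAs (MeasurableSingletonClass (Fin m → Fin p → ℝ))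
  infer_instance

/-- Convergence of a linear recursion with the gains `a` and `b`, driven by a uniformly ergodic
Markov chain whose mean dynamics is coercive. -/
theorem tendsto_of_gainConditions {E : Type*} [NormedAddCommGroup E] [InnerProductSpace ℝ E]
    [CompleteSpace E] {Ω : Type*} [m0 : MeasurableSpace Ω] {μ : Measure Ω}
    [IsProbabilityMeasure μ] {S : Type*} [Countable S] [MeasurableSpace S]
    [DiscreteMeasurableSpace S] {P : S → S → ℝ} {π : S → ℝ} (hP : IsTransitionMatrix P)
    (hπ : IsStationaryDistribution P π) (herg : IsUniformlyErgodic P π)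
    (𝒢 : Filtration ℕ m0) {F : ℕ → MeasurableSpace Ω}
    (h𝒢F : ∀ k, 𝒢 k ≤ F k) (hF𝒢 : ∀ k, F k ≤ 𝒢 (k + 1)) {Y : ℕ → Ω → S}
    (hY : ∀ k, Measurable[𝒢 k] (Y k))
    (hmarkov : ∀ k (g : S → E →L[ℝ] E) (C : ℝ), (∀ s, ‖g s‖ ≤ C) →
      μ[fun ω => g (Y (k + 1) ω) | F k] =ᵐ[μ] fun ω => transitionOp P g (Y k ω))
    {a b : ℕ → ℝ} (hgain : GainConditions a b) (hb : Summable fun k => b k ^ 2)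
    {f h : S → E →L[ℝ] E} {Cf Ch : ℝ} (hf : ∀ s, ‖f s‖ ≤ Cf) (hh : ∀ s, ‖h s‖ ≤ Ch)
    (hcoer : ∀ κ > 0, ∃ c > 0, ∀ (p q : ℝ), 0 ≤ p → κ * p ≤ q → ∀ x : E,
      c * p * ‖x‖ ^ 2 ≤ inner ℝ x ((p • (∑' s, π s • f s) + q • (∑' s, π s • h s)) x))
    {β : ℝ} (hβ : 0 ≤ β) {x w : ℕ → Ω → E} (hx0 : StronglyMeasurable[𝒢 0] (x 0))
    (hx02 : MemLp (x 0) 2 μ) (hwm : ∀ k, StronglyMeasurable[F k] (w k))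
    (hw2 : ∀ k, MemLp (w k) 2 μ) (hw0 : ∀ k, μ[w k | 𝒢 k] =ᵐ[μ] 0)
    (hwβ : ∀ k, μ[fun ω => ‖w k ω‖ ^ 2 | 𝒢 k] ≤ᵐ[μ] fun _ => β)
    (hstep : ∀ k ω, x (k + 1) ω
      = x k ω - (a k • f (Y k ω) + b k • h (Y k ω)) (x k ω) + a k • w k ω) :
    (∀ k, MemLp (x k) 2 μ) ∧ Tendsto (fun k => ∫ ω, ‖x k ω‖ ^ 2 ∂μ) atTop (𝓝 0) ∧
      ∀ᵐ ω ∂μ, Tendsto (fun k => x k ω) atTop (𝓝 0) := by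
  obtain ⟨gf, Kf, hgf, hpf⟩ := hP.exists_poisson hπ herg hf
  obtain ⟨gh, Kh, hgh, hph⟩ := hP.exists_poisson hπ herg hh
  set G := ∑' s, π s • f s
  set L := ∑' s, π s • h s
  have hS : Nonempty S := by
    by_contra hne
    rw [not_nonempty_iff] at hne
    exact zero_ne_one (hasSum_empty.unique hπ.hasSum_one)
  obtain ⟨s₀⟩ := hS
  have hCf0 : 0 ≤ Cf := (norm_nonneg _).trans (hf s₀)
  have hCh0 : 0 ≤ Ch := (norm_nonneg _).trans (hh s₀)
  have hKf0 : 0 ≤ Kf := (norm_nonneg _).trans (hgf s₀)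
  have hKh0 : 0 ≤ Kh := (norm_nonneg _).trans (hgh s₀)
  have ha0 : ∀ k, 0 ≤ a k := fun k => (hgain.a_pos k).le
  have hb0 : ∀ k, 0 ≤ b k := fun k => (hgain.b_pos k).le
  -- As `b` never vanishes, `a = O(b)` holds with one constant at all times; its inverse serves as
  -- `κ` in the coercivity.
  obtain ⟨r, hr, hab⟩ := bound_of_isBigO_nat_atTop hgain.a_isBigO_b
  have hab' : ∀ k, a k ≤ r * b k := fun k => by
    have := hab (hgain.b_pos k).ne'
    rwa [Real.norm_of_nonneg (ha0 k), Real.norm_of_nonneg (hb0 k)] at this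
  obtain ⟨c, hc, hcoer⟩ := hcoer r⁻¹ (inv_pos.2 hr)
  -- Chosen so that the single sequence `M * b k` dominates both the operators and their correctors.
  set M := r * Cf + Ch + (r * Kf + Kh) with hM
  have hnorm : ∀ k (X Z : E →L[ℝ] E) (p q : ℝ), ‖X‖ ≤ p → ‖Z‖ ≤ q →
      ‖a k • X + b k • Z‖ ≤ (r * p + q) * b k := by
    intro k X Z p q hX hZ
    have hp : 0 ≤ p := (norm_nonneg _).trans hX
    refine (norm_add_le _ _).trans ?_
    rw [norm_smul, norm_smul, Real.norm_of_nonneg (ha0 k), Real.norm_of_nonneg (hb0 k)]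
    calc a k * ‖X‖ + b k * ‖Z‖ ≤ (r * b k) * p + b k * q :=
          add_le_add (mul_le_mul (hab' k) hX (norm_nonneg _) (mul_nonneg hr.le (hb0 k)))
            (mul_le_mul_of_nonneg_left hZ (hb0 k))
      _ = _ := by ring
  refine tendsto_of_markov_recursion (μ := μ) hP 𝒢 (F := F)
    (D := fun k s => a k • f s + b k • h s)
    (Γ := fun k s => a k • gf s + b k • gh s) (D' := fun k => a k • G + b k • L)
    (b := fun k => M * b k) (Δ := fun k => Kf * (a k - a (k + 1)) + Kh * (b k - b (k + 1)))
    h𝒢F hF𝒢 hY hmarkov ?_ ?_ ha0 hc hβ ?_ ?_ ?_ ?_ ?_ ?_ ?_ ?_ hgain.sum_a hx0 hx02 hwm hw2 hw0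
    hwβ hstep
  · simpa using hgain.b_tendsto.const_mul M
  · exact hgain.b_antitone.const_mul (by positivity)
  · intro k s
    refine (hnorm k _ _ _ _ (hf s) (hh s)).trans (mul_le_mul_of_nonneg_right ?_ (hb0 k))
    have : 0 ≤ r * Kf + Kh := by positivity
    linarith
  · intro k s
    refine (hnorm k _ _ _ _ (hgf s) (hgh s)).trans (mul_le_mul_of_nonneg_right ?_ (hb0 k))
    have : 0 ≤ r * Cf + Ch := by positivity
    linarith
  · intro k s
    have h1 : 0 ≤ a k - a (k + 1) := sub_nonneg.2 (hgain.a_antitone k.le_succ)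
    have h2 : 0 ≤ b k - b (k + 1) := sub_nonneg.2 (hgain.b_antitone k.le_succ)
    have h3 : a (k + 1) • gf s + b (k + 1) • gh s - (a k • gf s + b k • gh s)
        = -((a k - a (k + 1)) • gf s + (b k - b (k + 1)) • gh s) := by
      simp only [sub_smul]; abel
    simp only [h3, norm_neg]
    refine (norm_add_le _ _).trans ?_
    rw [norm_smul, norm_smul, Real.norm_of_nonneg h1, Real.norm_of_nonneg h2, mul_comm Kf,
      mul_comm Kh]
    exact add_le_add (mul_le_mul_of_nonneg_left (hgf s) h1) (mul_le_mul_of_nonneg_left (hgh s) h2)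
  · intro k s
    rw [transitionOp_add_smul hP hgf hgh]
    have e1 : f s = G + gf s - transitionOp P gf s := by
      rw [add_sub_assoc, hpf s]; abel
    have e2 : h s = L + gh s - transitionOp P gh s := by
      rw [add_sub_assoc, hph s]; abel
    rw [e1, e2]
    simp only [smul_sub, smul_add]
    abel
  · intro k z
    refine hcoer (a k) (b k) (ha0 k) ?_ z
    rw [inv_mul_le_iff₀ hr]
    exact hab' k
  · simpa only [mul_pow] using hb.mul_left (M ^ 2)
  · refine Summable.of_nonneg_of_le (fun k => sq_nonneg _) (fun k => ?_) (hb.mul_left (r ^ 2))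
    rw [← mul_pow]
    exact pow_le_pow_left₀ (ha0 k) (hab' k) 2
  · exact ((summable_sub_succ_of_antitone hgain.a_antitone ha0).mul_left Kf).add
      ((summable_sub_succ_of_antitone hgain.b_antitone hb0).mul_left Kh)

theorem hasSum_smul_clm_of_bounded {S E : Type*} [NormedAddCommGroup E] [InnerProductSpace ℝ E]
    [CompleteSpace E] {p : S → ℝ} (hp : Summable fun s => |p s|) {f : S → E →L[ℝ] E} {C : ℝ}
    (hf : ∀ s, ‖f s‖ ≤ C) : HasSum (fun s => p s • f s) (∑' s, p s • f s) :=
  (summable_smul_of_bounded hp hf).hasSum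

theorem condExp_markov_clm {E : Type*} [NormedAddCommGroup E] [InnerProductSpace ℝ E]
    [CompleteSpace E] {Ω : Type*} {n m0 : MeasurableSpace Ω} {μ : Measure Ω}
    [IsProbabilityMeasure μ] {S : Type*} [Countable S] [MeasurableSpace S]
    [DiscreteMeasurableSpace S] {P : S → S → ℝ} (hP : IsTransitionMatrix P) {Y : ℕ → Ω → S}
    (hY : ∀ k, Measurable (Y k))
    (hmarkov : ∀ (k : ℕ) (p : ℕ → S), μ.real {ω | ∀ i ≤ k + 1, Y i ω = p i} =
      μ.real {ω | ∀ i ≤ k, Y i ω = p i} * P (p k) (p (k + 1))) (k : ℕ) (hn : n ≤ m0)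
    (hind : Indep (MeasurableSpace.comap (fun ω j => Y j ω) inferInstance) n μ)
    (g : S → E →L[ℝ] E) (C : ℝ) (hg : ∀ s, ‖g s‖ ≤ C) :
    μ[fun ω => g (Y (k + 1) ω) | histSigma Y (k + 1) ⊔ n]
      =ᵐ[μ] fun ω => transitionOp P g (Y k ω) :=
  condExp_markov_sup hP hY hmarkov hg k hn hind

variable {N n : ℕ} {d : Fin N → ℕ} {S : Set (NetState N n d)}

/-- The noise that enters the recursion of the stacked estimates. -/
noncomputable def netNoise {Ω : Type*} (Y : ℕ → Ω → S) (v : ℕ → Ω → NoiseFamily N d) (k : ℕ) (ω : Ω) :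
    NetSpace N n :=
  ∑ i, noiseOp (Y k ω).1.1 i (v k ω i)

/-! ### Conditional moments of the stacked noise. -/

section Noise

variable {Ω : Type*} [DiscreteMeasurableSpace S] [Countable S] {Y : ℕ → Ω → S}
  {v : ℕ → Ω → NoiseFamily N d}

theorem netNoise_term_measurable {m : MeasurableSpace Ω} {k : ℕ} (hY : Measurable[m] (Y k))
    (hv : Measurable[m] (v k)) (i : Fin N) :
    StronglyMeasurable[m] fun ω => noiseOp (n := n) (Y k ω).1.1 i (v k ω i) :=
  stronglyMeasurable_clm_apply
    ((StronglyMeasurable.of_discrete (f := fun s : S => noiseOp s.1.1 i)).comp_measurable hY)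
    ((measurable_pi_apply i).comp hv).stronglyMeasurable

theorem netNoise_measurable {m : MeasurableSpace Ω} {k : ℕ} (hY : Measurable[m] (Y k))
    (hv : Measurable[m] (v k)) : StronglyMeasurable[m] (netNoise Y v k) :=
  Finset.stronglyMeasurable_fun_sum _ fun i _ => netNoise_term_measurable hY hv i

variable {K : ℝ} (hK : ∀ (s : S) i, ‖noiseOp s.1.1 i‖ ≤ K)
include hK

theorem netNoise_term_memLp {m0 : MeasurableSpace Ω} {μ : Measure Ω} {k : ℕ} (hY : Measurable (Y k)) (hv : Measurable (v k))
    (hv2 : ∀ i, MemLp (fun ω => v k ω i) 2 μ) (i : Fin N) :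
    MemLp (fun ω => noiseOp (n := n) (Y k ω).1.1 i (v k ω i)) 2 μ :=
  (hv2 i).of_le_mul (c := K) (netNoise_term_measurable hY hv i).aestronglyMeasurable
    (ae_of_all _ fun ω => ContinuousLinearMap.le_of_opNorm_le _ (hK (Y k ω) i) _)

theorem netNoise_memLp {m0 : MeasurableSpace Ω} {μ : Measure Ω} {k : ℕ} (hY : Measurable (Y k)) (hv : Measurable (v k))
    (hv2 : ∀ i, MemLp (fun ω => v k ω i) 2 μ) : MemLp (netNoise Y v k) 2 μ :=
  memLp_finsetSum _ fun i _ => netNoise_term_memLp hK hY hv hv2 i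

/-- The observation matrices multiplying the noise are `m`-measurable and come out of the
conditional expectation. -/
theorem condExp_netNoise_eq_zero {m m0 : MeasurableSpace Ω} {μ : Measure Ω}
    [IsFiniteMeasure μ] {k : ℕ} (hY : Measurable (Y k))
    (hv : Measurable (v k)) (hYm : Measurable[m] (Y k)) (hv2 : ∀ i, MemLp (fun ω => v k ω i) 2 μ)
    (hv0 : ∀ i, μ[fun ω => v k ω i | m] =ᵐ[μ] 0) : μ[netNoise Y v k | m] =ᵐ[μ] 0 := by
  have hsum : netNoise Y v k = ∑ i, fun ω => noiseOp (n := n) (Y k ω).1.1 i (v k ω i) := by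
    ext1 ω
    simp [netNoise]
  have hi : ∀ i, Integrable (fun ω => noiseOp (n := n) (Y k ω).1.1 i (v k ω i)) μ := fun i =>
    (netNoise_term_memLp hK hY hv hv2 i).integrable one_le_two
  have h1 : ∀ i, μ[fun ω => noiseOp (n := n) (Y k ω).1.1 i (v k ω i) | m] =ᵐ[μ] 0 := by
    intro i
    have hm : StronglyMeasurable[m] fun ω => noiseOp (n := n) (Y k ω).1.1 i :=
      (StronglyMeasurable.of_discrete (f := fun s : S => noiseOp s.1.1 i)).comp_measurable hYm
    filter_upwards [condExp_clm_apply hm (hi i) ((hv2 i).integrable one_le_two), hv0 i]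
      with ω h2 h3
    rw [h2, h3]
    simp
  rw [hsum]
  filter_upwards [condExp_finsetSum (fun i (_ : i ∈ Finset.univ) => hi i) m, ae_all_iff.2 h1]
    with ω h2 h3
  rw [h2, Finset.sum_apply]
  simp [h3]

theorem condExp_norm_sq_netNoise_le {m m0 : MeasurableSpace Ω} {μ : Measure Ω}
    [IsFiniteMeasure μ] {k : ℕ} (hY : Measurable (Y k))
    (hv : Measurable (v k)) (hv2 : ∀ i, MemLp (fun ω => v k ω i) 2 μ) {β : ℝ}
    (hvβ : ∀ᵐ ω ∂μ, (μ[fun ω => ∑ i, ‖v k ω i‖ ^ 2 | m]) ω ≤ β) :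
    μ[fun ω => ‖netNoise Y v k ω‖ ^ 2 | m] ≤ᵐ[μ] fun _ => N * K ^ 2 * β := by
  have hle : ∀ ω, ‖netNoise Y v k ω‖ ^ 2 ≤ ((N * K ^ 2) • fun ω => ∑ i, ‖v k ω i‖ ^ 2) ω := by
    intro ω
    have h1 : ‖netNoise Y v k ω‖ ≤ ∑ i, K * ‖v k ω i‖ :=
      (norm_sum_le _ _).trans (Finset.sum_le_sum fun i _ =>
        ContinuousLinearMap.le_of_opNorm_le _ (hK (Y k ω) i) _)
    calc ‖netNoise Y v k ω‖ ^ 2 ≤ (∑ i, K * ‖v k ω i‖) ^ 2 :=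
          pow_le_pow_left₀ (norm_nonneg _) h1 2
      _ ≤ (Finset.univ : Finset (Fin N)).card * ∑ i, (K * ‖v k ω i‖) ^ 2 :=
          sq_sum_le_card_mul_sum_sq
      _ = _ := by
        simp only [mul_pow, ← Finset.mul_sum, Finset.card_univ, Fintype.card_fin, Pi.smul_apply,
          smul_eq_mul, mul_assoc]
  have hint : Integrable (fun ω => ∑ i, ‖v k ω i‖ ^ 2) μ :=
    integrable_finsetSum _ fun i _ => (hv2 i).integrable_norm_pow two_ne_zero
  filter_upwards [condExp_mono (m := m)
    ((netNoise_memLp hK hY hv hv2).integrable_norm_pow two_ne_zero)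
    (hint.smul (N * K ^ 2 : ℝ)) (ae_of_all _ hle),
    condExp_smul (N * K ^ 2 : ℝ) (fun ω => ∑ i, ‖v k ω i‖ ^ 2) m (μ := μ), hvβ] with ω h1 h2 h3
  refine h1.trans ?_
  rw [h2, Pi.smul_apply, smul_eq_mul]
  exact mul_le_mul_of_nonneg_left h3 (by positivity)

end Noise

/-- The operator of one step of the recursion of the stacked errors. -/
noncomputable def stepOp (a b : ℝ) (s : NetState N n d) : NetSpace N n →L[ℝ] NetSpace N n :=
  a • obsOp s.1 + b • lapOp s.2

variable {Ω : Type*} [m0 : MeasurableSpace Ω] {μ : Measure Ω} [IsProbabilityMeasure μ]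

/-- Convergence of the stacked errors, for a chain with values in the state space and noises whose
conditional moments are controlled given their own past. -/
theorem tendsto_netError [DiscreteMeasurableSpace S] [Countable S]
    {Y : ℕ → Ω → S} {v : ℕ → Ω → NoiseFamily N d}
    (hY : ∀ k, Measurable (Y k)) (hv : ∀ k, Measurable (v k))
    (hindep : IndepFun (fun ω k => v k ω) (fun ω k => Y k ω) μ)
    (hv2 : ∀ k i, MemLp (fun ω => v k ω i) 2 μ)
    (hv0 : ∀ k i, μ[fun ω => v k ω i | histSigma v k] =ᵐ[μ] 0) {β : ℝ} (hβ : 0 ≤ β)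
    (hvβ : ∀ k, ∀ᵐ ω ∂μ, (μ[fun ω => ∑ i, ‖v k ω i‖ ^ 2 | histSigma v k]) ω ≤ β)
    {a b : ℕ → ℝ} (hgain : GainConditions a b) (hb : Summable fun k => b k ^ 2)
    {P : S → S → ℝ} {π : S → ℝ} (hP : IsTransitionMatrix P)
    (hmarkov : ∀ (k : ℕ) (p : ℕ → S), μ.real {ω | ∀ i ≤ k + 1, Y i ω = p i} =
      μ.real {ω | ∀ i ≤ k, Y i ω = p i} * P (p k) (p (k + 1)))
    (hπ : IsStationaryDistribution P π) (herg : IsUniformlyErgodic P π)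
    {C : ℝ} (hC : 0 ≤ C) (hA : ∀ (s : S) i j, |s.1.2 i j| ≤ C)
    (hH : ∀ (s : S) i p q, |s.1.1 i p q| ≤ C)
    (hnonneg : ∀ i j, 0 ≤ meanAdjacency π i j) (hbal : IsBalanced (meanAdjacency π))
    (htree : HasSpanningTree (meanAdjacency π)) (hobs : 0 < lambdaMin (meanGramian π))
    {e : ℕ → Ω → NetSpace N n} {e₀ : NetSpace N n} (he0 : ∀ ω, e 0 ω = e₀)
    (hstep : ∀ k ω, e (k + 1) ω = e k ω
      - stepOp (a k) (b k) (Y k ω).1 (e k ω) + a k • netNoise Y v k ω) :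
    (∀ k, MemLp (e k) 2 μ) ∧ Tendsto (fun k => ∫ ω, ‖e k ω‖ ^ 2 ∂μ) atTop (𝓝 0) ∧
      ∀ᵐ ω ∂μ, Tendsto (fun k => e k ω) atTop (𝓝 0) := by
  obtain ⟨Kw, -, hKw⟩ := exists_norm_noiseOp_le (N := N) (n := n) (d := d) (C := C)
  obtain ⟨CG, hCG⟩ := exists_norm_obsOp_le (N := N) (n := n) (d := d) (C := C)
  obtain ⟨CL, hCL⟩ := exists_norm_lapOp_le (N := N) (n := n) (C := C)
  have hGb : ∀ s : S, ‖obsOp s.1.1‖ ≤ CG := fun s => hCG _ (hH s)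
  have hLb : ∀ s : S, ‖lapOp (n := n) s.1.2‖ ≤ CL := fun s => hCL _ (hA s)
  have hKs : ∀ (s : S) i, ‖noiseOp s.1.1 i‖ ≤ Kw := fun s => hKw _ (hH s)
  have hπs : Summable fun s => |π s| := hπ.hasSum_one.summable.abs
  have hGsum := hasSum_smul_clm_of_bounded hπs hGb
  have hLsum := hasSum_smul_clm_of_bounded hπs hLb
  have hvall : MeasurableSpace.comap (fun ω k => v k ω) inferInstance ≤ m0 :=
    (measurable_pi_iff.2 hv).comap_le
  have hind : Indep (MeasurableSpace.comap (fun ω k => v k ω) inferInstance)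
      (MeasurableSpace.comap (fun ω k => Y k ω) inferInstance) μ :=
    (IndepFun_iff_Indep _ _ _).1 hindep
  -- The chain is known up to time `k` but the noise only up to `k - 1`: the step operator at time
  -- `k` is then measurable while its noise is still centred.
  let 𝒢 : Filtration ℕ m0 :=
    ⟨fun k => histSigma Y (k + 1) ⊔ histSigma v k,
      fun i j hij => sup_le_sup (histSigma_mono Y (Nat.add_le_add_right hij 1))
        (histSigma_mono v hij),
      fun k => sup_le (histSigma_le hY _) (histSigma_le hv _)⟩
  have hY𝒢 : ∀ k, Measurable[𝒢 k] (Y k) := fun k =>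
    (measurable_histSigma Y k.lt_succ_self).mono le_sup_left le_rfl
  -- For functionals of the noise, the independent chain part of `𝒢 k` can be dropped.
  have hcond : ∀ {V : Type} [NormedAddCommGroup V] [NormedSpace ℝ V] [CompleteSpace V] (k : ℕ)
      {f : Ω → V}, StronglyMeasurable[MeasurableSpace.comap (fun ω k => v k ω) inferInstance] f →
      Integrable f μ → μ[f | 𝒢 k] =ᵐ[μ] μ[f | histSigma v k] := by
    intro V _ _ _ k f hf hfi
    have h := condExp_sup_of_indep (histSigma_le hY (k + 1)) hvall (histSigma_le_comap v k)
      (indep_of_indep_of_le_right hind (histSigma_le_comap Y (k + 1))) hf hfi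
    rwa [sup_comm] at h
  have hvm : ∀ k i, StronglyMeasurable[MeasurableSpace.comap (fun ω k => v k ω) inferInstance]
      fun ω => v k ω i := fun k i =>
    ((measurable_pi_apply i).comp ((measurable_pi_apply k).comp
      (comap_measurable fun ω k => v k ω))).stronglyMeasurable
  refine tendsto_of_gainConditions (μ := μ) hP hπ herg 𝒢
    (F := fun k => histSigma Y (k + 1) ⊔ histSigma v (k + 1))
    (fun k => sup_le_sup_left (histSigma_mono v k.le_succ) _)
    (fun k => sup_le_sup_right (histSigma_mono Y (k + 1).le_succ) _) hY𝒢 ?_ hgain hb hGb hLb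
    (fun κ hκ => exists_mean_coercive hπ.hasSum_one.summable hπ.nonneg hC hA hH hnonneg
      hbal htree hobs hGsum hLsum hκ)
    (β := N * Kw ^ 2 * β) (by positivity) ?_ ?_ ?_
    (fun k => netNoise_memLp hKs (hY k) (hv k) (hv2 k)) ?_ ?_ hstep
  · intro k
    exact condExp_markov_clm hP hY hmarkov k (histSigma_le hv _)
      (indep_of_indep_of_le_right hind.symm (histSigma_le_comap v (k + 1)))
  · rw [funext he0]; exact stronglyMeasurable_const
  · rw [funext he0]; exact memLp_const _
  · intro k
    have h1 : Measurable[histSigma Y (k + 1) ⊔ histSigma v (k + 1)] (Y k) :=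
      (measurable_histSigma Y k.lt_succ_self).mono le_sup_left le_rfl
    have h2 : Measurable[histSigma Y (k + 1) ⊔ histSigma v (k + 1)] (v k) :=
      (measurable_histSigma v k.lt_succ_self).mono le_sup_right le_rfl
    exact netNoise_measurable h1 h2
  · exact fun k => condExp_netNoise_eq_zero hKs (hY k) (hv k) (hY𝒢 k) (hv2 k) fun i =>
      (hcond k (hvm k i) ((hv2 k i).integrable one_le_two)).trans (hv0 k i)
  · intro k
    refine condExp_norm_sq_netNoise_le hKs (hY k) (hv k) (hv2 k) ?_
    have h := hcond k (f := fun ω => ∑ i, ‖v k ω i‖ ^ 2)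
      (Finset.stronglyMeasurable_fun_sum _ fun i _ => (hvm k i).norm.pow 2)
      (integrable_finsetSum _ fun i _ => (hv2 k i).integrable_norm_pow two_ne_zero)
    filter_upwards [h, hvβ k] with ω h1 h2
    rwa [h1]

/-- The stacked errors, driven by a state-space valued chain. -/
noncomputable def netError (a b : ℕ → ℝ) (Y : ℕ → Ω → S) (v : ℕ → Ω → NoiseFamily N d)
    (e₀ : NetSpace N n) : ℕ → Ω → NetSpace N n
  | 0 => fun _ => e₀
  | k + 1 => fun ω => netError a b Y v e₀ k ω
      - stepOp (a k) (b k) (Y k ω).1 (netError a b Y v e₀ k ω)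
      + a k • netNoise Y v k ω

/-- Subtracting `x₀` leaves the consensus differences unchanged and turns the innovation into `v i`
minus `H i` applied to the error. -/
theorem estimateStep_sub (a b : ℝ) (s : NetState N n d) (x₀ : EuclideanSpace ℝ (Fin n))
    (v : NoiseFamily N d) (x : Fin N → EuclideanSpace ℝ (Fin n)) (e : NetSpace N n)
    (he : ∀ i, x i - x₀ = e i) (i : Fin N) :
    estimateStep a b s.1 s.2 (measurement x₀ s.1 v) x i - x₀
      = (e - stepOp a b s e + a • ∑ j, noiseOp s.1 j (v j) : NetSpace N n) i := by
  have hx : ∀ i, x i = e i + x₀ := fun i => by rw [← he i, sub_add_cancel]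
  -- Non-neighbours carry weight zero, so the sum may run over all nodes.
  have hsum : ∑ j ∈ neighbours s.2 i, s.2 i j • (x j - x i) = -∑ j, s.2 i j • (e i - e j) := by
    classical
    rw [← Finset.sum_neg_distrib]
    have h1 : ∀ j, s.2 i j • (x j - x i) = -(s.2 i j • (e i - e j)) := fun j => by
      rw [hx, hx, ← smul_neg]; congr 1; abel
    simp only [h1]
    refine Finset.sum_subset (Finset.subset_univ _) fun j _ hj => ?_
    have h0 : s.2 i j = 0 := by
      by_contra h
      exact hj (by simp only [neighbours, Finset.mem_filter]; exact ⟨Finset.mem_univ j, h⟩)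
    simp [h0]
  have hm : measurement x₀ s.1 v i - Matrix.toEuclideanLin (s.1 i) (x i)
      = v i - matCLM (s.1 i) (e i) := by
    rw [measurement, hx i, map_add, matCLM_apply]; abel
  rw [estimateStep, hsum, hm, ← matCLM_apply, map_sub]
  simp only [stepOp, PiLp.add_apply, PiLp.sub_apply, PiLp.smul_apply, add_apply, smul_apply, obsOp_apply,
    lapOp_apply, sum_noiseOp_apply]
  rw [hx i, smul_sub, smul_neg]
  abel

end Network

/-! ### Reduction of the estimation problem to the stacked error recursion. -/

theorem corollary1
    {Ω : Type*} [MeasurableSpace Ω] (μ : Measure Ω) [IsProbabilityMeasure μ]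
    (N n : ℕ) (d : Fin N → ℕ)
    -- the unknown parameter, observation matrices, adjacency matrices and noises
    (x₀ : EuclideanSpace ℝ (Fin n))
    (H : ℕ → Ω → ObsFamily N n d)
    (A : ℕ → Ω → Matrix (Fin N) (Fin N) ℝ)
    (v : ℕ → Ω → NoiseFamily N d)
    (hH : ∀ k, Measurable (H k)) (hA : ∀ k, Measurable (A k)) (hv : ∀ k, Measurable (v k))
    (hA_diag : ∀ k i, ∀ᵐ ω ∂μ, A k ω i i = 0)
    -- noise: independence, martingale difference with bounded conditional second moments
    (hindep : IndepFun (fun ω k => v k ω) (fun ω k => (H k ω, A k ω)) μ)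
    (hnoise : IsMartingaleDifferenceNoise μ H A v)
    -- gains
    (a b : ℕ → ℝ) (hgain : GainConditions a b) (hb : Summable fun k => b k ^ 2)
    -- the Markov chain
    (S : Set (NetState N n d)) (hS : S.Countable)
    (P : S → S → ℝ) (π : S → ℝ)
    (hchain : IsHomogeneousMarkovChain μ S P fun k ω => (H k ω, A k ω))
    (hπ : IsStationaryDistribution P π)
    (hπ_unique : ∀ π' : S → ℝ, IsStationaryDistribution P π' → π' = π)
    (herg : IsUniformlyErgodic P π)
    -- bounded states
    (hA_bdd : BddAbove (Set.range fun s : S => matrixTwoNorm s.1.2))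
    (hH_bdd : BddAbove (Set.range fun s : S => matrixTwoNorm (blockObs s.1.1)))
    -- the stationary graph is nonnegative and balanced with a spanning tree
    (hnonneg : ∀ i j, 0 ≤ meanAdjacency π i j)
    (hbal : IsBalanced (meanAdjacency π))
    (htree : HasSpanningTree (meanAdjacency π))
    -- spatial-temporal joint observability
    (hobs : 0 < lambdaMin (meanGramian π))
    -- the delay-free algorithm with deterministic initial estimates
    (x : ℕ → Ω → Fin N → EuclideanSpace ℝ (Fin n))
    (xinit : Fin N → EuclideanSpace ℝ (Fin n))
    (hx_init : ∀ᵐ ω ∂μ, x 0 ω = xinit)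
    (hx_step : ∀ k i, ∀ᵐ ω ∂μ, x (k + 1) ω i =
      estimateStep (a k) (b k) (H k ω) (A k ω) (measurement x₀ (H k ω) (v k ω)) (x k ω) i) :
    (∀ i, (∀ k, Integrable (fun ω => ‖x k ω i - x₀‖ ^ 2) μ) ∧
      Tendsto (fun k => ∫ ω, ‖x k ω i - x₀‖ ^ 2 ∂μ) atTop (𝓝 0)) ∧
    (∀ᵐ ω ∂μ, ∀ i, Tendsto (fun k => x k ω i) atTop (𝓝 x₀)) := by
  classical
  have hsing := measurableSingletonClass_netState N n d
  have hcount : Countable S := hS.to_subtype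
  have hSne : Nonempty S := by
    by_contra h
    rw [not_nonempty_iff] at h
    exact zero_ne_one (hasSum_empty.unique hπ.hasSum_one)
  obtain ⟨s₀⟩ := hSne
  -- a modification of the chain that stays in the state space
  have hmem : ∀ y : NetState N n d, (if y ∈ S then y else s₀.1) ∈ S := fun y => by
    split_ifs with h
    · exact h
    · exact s₀.2
  set φ : NetState N n d → S := fun y => ⟨if y ∈ S then y else s₀.1, hmem y⟩ with hφdef
  have hφ : Measurable φ :=
    (Measurable.ite hS.measurableSet measurable_id measurable_const).subtype_mk
  have hφS : ∀ y ∈ S, (φ y).1 = y := fun y hy => by simp [hφdef, hy]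
  set Y : ℕ → Ω → S := fun k ω => φ (H k ω, A k ω) with hYdef
  have hYm : ∀ k, Measurable (Y k) := fun k => hφ.comp ((hH k).prodMk (hA k))
  have hYeq : ∀ᵐ ω ∂μ, ∀ k, (Y k ω).1 = (H k ω, A k ω) := by
    filter_upwards [ae_all_iff.2 hchain.mem] with ω hω k
    exact hφS _ (hω k)
  have hφseq : Measurable fun (y : ℕ → NetState N n d) k => φ (y k) :=
    measurable_pi_iff.2 fun k => hφ.comp (measurable_pi_apply k)
  have hindepY : IndepFun (fun ω k => v k ω) (fun ω k => Y k ω) μ :=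
    hindep.comp (φ := id) (ψ := fun (y : ℕ → NetState N n d) k => φ (y k)) measurable_id hφseq
  have hset : ∀ (k : ℕ) (p : ℕ → S), μ.real {ω | ∀ i ≤ k, Y i ω = p i}
      = μ.real {ω | ∀ i ≤ k, (H i ω, A i ω) = ((p i : S) : NetState N n d)} := by
    intro k p
    refine measureReal_congr ?_
    filter_upwards [hYeq] with ω hω
    refine propext (forall₂_congr fun i _ => ?_)
    rw [Subtype.ext_iff, hω i]
  have hmarkov : ∀ (k : ℕ) (p : ℕ → S), μ.real {ω | ∀ i ≤ k + 1, Y i ω = p i} =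
      μ.real {ω | ∀ i ≤ k, Y i ω = p i} * P (p k) (p (k + 1)) := by
    intro k p
    rw [hset, hset]
    exact hchain.markov k p
  -- The given past lacks the current `H k` and `A k`. The noise conditions are therefore lowered to
  -- the noise's own history by the tower property; `tendsto_netError` adds the chain back by
  -- independence.
  have hpast : ∀ k, histSigma v k ≤ pastSigma H A v k := fun k =>
    iSup₂_mono fun j _ => by
      rw [← measurable_iff_comap_le]
      exact (measurable_snd.comp measurable_snd).comp
        (comap_measurable fun ω => (H j ω, A j ω, v j ω))
  have hpast0 : ∀ k, pastSigma H A v k ≤ ‹MeasurableSpace Ω› := fun k =>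
    iSup₂_le fun j _ => ((hH j).prodMk ((hA j).prodMk (hv j))).comap_le
  have hv0 : ∀ k i, μ[fun ω => v k ω i | histSigma v k] =ᵐ[μ] 0 := fun k i => by
    refine (condExp_condExp_of_le (hpast k) (hpast0 k)).symm.trans
      ((condExp_congr_ae (hnoise.condExp_eq_zero k i)).trans ?_)
    rw [condExp_zero]
  obtain ⟨β, hβ, hvβ⟩ := hnoise.condSecondMoment_le
  have hvβ' : ∀ k, ∀ᵐ ω ∂μ, (μ[fun ω => ∑ i, ‖v k ω i‖ ^ 2 | histSigma v k]) ω ≤ β := fun k => by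
    have h1 := condExp_condExp_of_le (μ := μ) (f := fun ω => ∑ i, ‖v k ω i‖ ^ 2)
      (hpast k) (hpast0 k)
    have h2 : μ[μ[fun ω => ∑ i, ‖v k ω i‖ ^ 2 | pastSigma H A v k] | histSigma v k]
        ≤ᵐ[μ] μ[fun _ => β | histSigma v k] :=
      condExp_mono integrable_condExp (integrable_const _) (hvβ k)
    rw [condExp_const ((hpast k).trans (hpast0 k))] at h2
    filter_upwards [h1, h2] with ω h3 h4
    rwa [← h3]
  obtain ⟨CA, hCA⟩ := hA_bdd
  obtain ⟨CH, hCH⟩ := hH_bdd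
  have hAb : ∀ (s : S) i j, |s.1.2 i j| ≤ max 0 (max CA CH) := fun s i j =>
    (abs_entry_le_matrixTwoNorm _ i j).trans
      ((hCA ⟨s, rfl⟩).trans ((le_max_left _ _).trans (le_max_right _ _)))
  have hHb : ∀ (s : S) i p q, |s.1.1 i p q| ≤ max 0 (max CA CH) := fun s i p q =>
    (abs_entry_le_blockObs _ i p q).trans
      ((hCH ⟨s, rfl⟩).trans ((le_max_right _ _).trans (le_max_right _ _)))
  set e₀ : NetSpace N n := WithLp.toLp 2 fun i => xinit i - x₀
  obtain ⟨hmemLp, hmean, has⟩ := tendsto_netError hYm hv hindepY hnoise.memLp hv0 hβ.le hvβ' hgain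
    hb hchain.transition hmarkov hπ herg (le_max_left _ _) hAb hHb hnonneg hbal htree hobs
    (e := netError a b Y v e₀) (e₀ := e₀) (fun _ => rfl) (fun _ _ => rfl)
  -- The algorithm is assumed only almost surely; on one full-measure event it coincides with the
  -- recursion `netError`, which is defined everywhere.
  have herr : ∀ᵐ ω ∂μ, ∀ k i, x k ω i - x₀ = netError a b Y v e₀ k ω i := by
    filter_upwards [hx_init, ae_all_iff.2 fun k => ae_all_iff.2 fun i => hx_step k i, hYeq]
      with ω h0 hs hy k
    induction k with
    | zero => intro i; rw [h0]; rfl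
    | succ k ih =>
      intro i
      rw [hs k i]
      have h := estimateStep_sub (a k) (b k) (Y k ω).1 x₀ (v k ω) (x k ω) _ ih i
      rw [hy k] at h
      refine h.trans ?_
      simp only [netError, netNoise, hy k]
  have hle : ∀ i k, ∀ᵐ ω ∂μ, ‖x k ω i - x₀‖ ^ 2 = ‖netError a b Y v e₀ k ω i‖ ^ 2 := fun i k => by
    filter_upwards [herr] with ω hω
    rw [hω k i]
  have hint : ∀ i k, Integrable (fun ω => ‖netError a b Y v e₀ k ω i‖ ^ 2) μ := fun i k =>
    ((hmemLp k).continuousLinearMap_comp (nodeProj i)).integrable_norm_pow two_ne_zero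
  refine ⟨fun i => ⟨fun k => (hint i k).congr ((hle i k).mono fun ω h => h.symm), ?_⟩, ?_⟩
  · refine squeeze_zero (fun k => integral_nonneg fun ω => sq_nonneg _) (fun k => ?_) hmean
    rw [integral_congr_ae (hle i k)]
    exact integral_mono (hint i k) ((hmemLp k).integrable_norm_pow two_ne_zero) fun ω =>
      pow_le_pow_left₀ (norm_nonneg _) (PiLp.norm_apply_le _ i) 2
  · filter_upwards [herr, has] with ω h1 h2 i
    have h3 := ((nodeProj (N := N) (n := n) i).continuous.tendsto 0).comp h2
    rw [map_zero] at h3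
    have h4 := h3.add_const x₀
    rw [zero_add] at h4
    refine h4.congr fun k => ?_
    change netError a b Y v e₀ k ω i + x₀ = x k ω i
    rw [← h1 k i, sub_add_cancel]
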